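/- Let $\mathbb{O}$ be the algebra of complex octonions, that is, the complexification of the compact real Cayley algebra $\mathbb{O}_c$, with Cayley conjugation $a\mapsto\widetilde a$ (complex linear), norm $n$, bilinear form $(a:b)=n(a+b)-n(a)-n(b)$ and complex conjugation $a\mapsto\overline a$ with respect to $\mathbb{O}_c$. Let $H_3(\mathbb{O})$ be the $27$-dimensional complex space of $3\times3$ matrices $$a=\begin{pmatrix}\alpha_1&a_3&\widetilde{a_2}\\ \widetilde{a_3}&\alpha_2&a_1\\ a_2&\widetilde{a_1}&\alpha_3\end{pmatrix}=\sum_i\alpha_ie_i+\sum_iF_i(a_i)\qquad(\alpha_i\in\mathbb{C},\ a_i\in\mathbb{O}),$$ with $(a:b)=\sum_i\alpha_i\beta_i+\sum_i(a_i:b_i)$, $(a\mid b)=(a:\overline b)$ (entrywise complex conjugation), adjoint $$a^{\#}=\sum_i(\alpha_j\alpha_k-n(a_i))\,e_i+\sum_iF_i\big((a_ja_k-\alpha_i\widetilde{a_i})^{\sim}\big)$$ ($(i,j,k)$ an even permutation of $(1,2,3)$), Freudenthal product $a\times b=(a+b)^{\#}-a^{\#}-b^{\#}$, and triple product $$D(x,y)z=\{xyz\}=(x\mid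 y)z+(z\mid y)x-(x\times z)\times\overline y .$$ Let $W=\mathcal F_2\oplus\mathcal F_3$, where $\mathcal F_i=\{F_i(a):a\in\mathbb{O}\}$; it is closed under the triple product. Below, all notions are those of $W$ with the restricted product, $Q(x)y=\frac12\{xyx\}$, and $B(x,y)=I-D(x,y)+Q(x)Q(y)$. A tripotent is an $x$ with $Q(x)x=x$; tripotents $x,y$ are orthogonal if $D(x,y)=0$; a nonzero tripotent is minimal if it is not a sum of two nonzero orthogonal tripotents; a tripotent has rank $k$ if it is a sum of $k$ pairwise orthogonal minimal tripotents; a frame is a maximal finite sequence of pairwise orthogonal minimal tripotents. For a frame $(c_1,\dots,c_r)$ and $0\le i\le j\le r$ let $V_{ij}=\{z: D(c_k,c_k)z=(\delta_{ik}+\delta_{jk})z,\ 1\le k\le r\}$. Then: 1. $\dim_{\mathbb{C}}W=16$, and $W$ is a Hermitian Jordan triple system: $\{xyz\}$ is $\mathbb{C}$-linear and symmetric in $x,z$, antilinear in $y$, and $D(x,y)Q(x)=Q(x)D(y,x)$, $D(Q(x)y,y)=D(x,Q(y)x)$. It is positive: if $x\neq0$, $\lambda\in\mathbb{C}$ and $Q(x)x=\lambda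 x$, then $\lambda$ is real and $\lambda>0$; also, the form $\operatorname{Tr}D(x,y)$ is Hermitian and positive definite. It is simple: the triple product is not zero and the only ideals (complex subspaces $I$ with $\{xyz\}\in I$ whenever one of $x,y,z$ is in $I$) are $0$ and $W$. 2. The numerical invariants of $W$ are $a=6$, $b=4$, $r=2$, $g=12$. That is: the rank $r$, the degree of the generic minimal polynomial, equivalently the largest dimension of a subspace spanned by powers $x^{(1,y)}=x$, $x^{(k+1,y)}=\frac12D(x,y)x^{(k,y)}$ with $x,y\in W$, is $2$; frames exist, and every frame has exactly $2$ elements and satisfies $\dim V_{12}=a=6$ and $\dim V_{01}=\dim V_{02}=b=4$; and $g=2+a(r-1)+b=12$. 3. For all $x,y\in W$, with trace and determinant of $\mathbb{C}$-linear operators on $W$, $$\operatorname{Tr}D(x,y)=12\,(x\mid y),\qquad \operatorname{Det}B(x,y)=\big(1-(x\mid y)+(x^{\#}\mid y^{\#})\big)^{12}.$$ 4. The set of tripotents of $W$ is $\mathcal E'=\mathcal E'_0\cup\mathcal E'_1\cup\mathcal E'_2$, where $\mathcal E'_k$ is the set of tripotents of rank $k$, and $$\mathcal E'_0=\{0\},\quad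 \mathcal E'_1=\{x\in W:(x\mid x)=1,\ x^{\#}=0\},\quad \mathcal E'_2=\{x\in W:(x\mid x)=2,\ (x^{\#}\mid x^{\#})=1\}.$$ -/

import Mathlib

open scoped ComplexConjugate Quaternion

noncomputable section

namespace ExceptionalJTS

/-! ### Octonions -/

/-- The Cayley algebra over `R` obtained from the quaternions by the Cayley-Dickson process with
parameter `-1`: an element is `fst + v * snd`, where `fst`, `snd` are quaternions and `v ^ 2 = -1`.
`Octonion ℝ` is the compact real algebra of octonions; as all structure constants are integers,
`Octonion ℂ` is its complexification. -/
@[ext]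
structure Octonion (R : Type) [CommRing R] where
  fst : ℍ[R]
  snd : ℍ[R]

namespace Octonion

variable {R : Type} [CommRing R]

/-- An octonion as a pair of quaternions. -/
def equivProd (R : Type) [CommRing R] : Octonion R ≃ ℍ[R] × ℍ[R] where
  toFun x := (x.fst, x.snd)
  invFun p := ⟨p.1, p.2⟩
  left_inv _ := rfl
  right_inv _ := rfl

instance : AddCommGroup (Octonion R) := (equivProd R).addCommGroup

instance : Module R (Octonion R) := (equivProd R).module R

@[simp] theorem fst_zero : (0 : Octonion R).fst = 0 := rfl
@[simp] theorem snd_zero : (0 : Octonion R).snd = 0 := rfl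
@[simp] theorem fst_add (x y : Octonion R) : (x + y).fst = x.fst + y.fst := rfl
@[simp] theorem snd_add (x y : Octonion R) : (x + y).snd = x.snd + y.snd := rfl
@[simp] theorem fst_neg (x : Octonion R) : (-x).fst = -x.fst := rfl
@[simp] theorem snd_neg (x : Octonion R) : (-x).snd = -x.snd := rfl
@[simp] theorem fst_sub (x y : Octonion R) : (x - y).fst = x.fst - y.fst := rfl
@[simp] theorem snd_sub (x y : Octonion R) : (x - y).snd = x.snd - y.snd := rfl
@[simp] theorem fst_smul (c : R) (x : Octonion R) : (c • x).fst = c • x.fst := rfl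
@[simp] theorem snd_smul (c : R) (x : Octonion R) : (c • x).snd = c • x.snd := rfl

/-- The Cayley-Dickson product. -/
instance : Mul (Octonion R) :=
  ⟨fun x y => ⟨x.fst * y.fst - y.snd * star x.snd, star x.fst * y.snd + y.fst * x.snd⟩⟩

theorem mul_def (x y : Octonion R) :
    x * y = ⟨x.fst * y.fst - y.snd * star x.snd, star x.fst * y.snd + y.fst * x.snd⟩ := rfl

/-- The Cayley conjugation, which is `R`-linear. -/
def cayley (x : Octonion R) : Octonion R := ⟨star x.fst, -x.snd⟩

/-- The norm, which is an `R`-valued quadratic form. -/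
def n (x : Octonion R) : R := Quaternion.normSq x.fst + Quaternion.normSq x.snd

/-- The bilinear form `(x : y)` associated with the norm (without a factor `1 / 2`). -/
def bil (x y : Octonion R) : R := n (x + y) - n x - n y

/-- Complex conjugation of the four coordinates of a complex quaternion. -/
def quatConj (q : ℍ[ℂ]) : ℍ[ℂ] := ⟨conj q.re, conj q.imI, conj q.imJ, conj q.imK⟩

@[simp] theorem quatConj_re (q : ℍ[ℂ]) : (quatConj q).re = conj q.re := rfl
@[simp] theorem quatConj_imI (q : ℍ[ℂ]) : (quatConj q).imI = conj q.imI := rfl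
@[simp] theorem quatConj_imJ (q : ℍ[ℂ]) : (quatConj q).imJ = conj q.imJ := rfl
@[simp] theorem quatConj_imK (q : ℍ[ℂ]) : (quatConj q).imK = conj q.imK := rfl

/-- Complex conjugation with respect to the real form `Octonion ℝ`: the eight coordinates are
conjugated one by one. -/
def cconj (x : Octonion ℂ) : Octonion ℂ := ⟨quatConj x.fst, quatConj x.snd⟩

theorem oct_add_mul (x y z : Octonion R) : (x + y) * z = x * z + y * z := by
  ext1 <;> simp [mul_def, add_mul, mul_add] <;> abel

theorem oct_mul_add (x y z : Octonion R) : x * (y + z) = x * y + x * z := by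
  ext1 <;> simp [mul_def, add_mul, mul_add] <;> abel

theorem oct_smul_mul (c : R) (x y : Octonion R) : (c • x) * y = c • (x * y) := by
  ext1 <;> simp [mul_def, smul_sub, smul_add]

theorem oct_mul_smul (c : R) (x y : Octonion R) : x * (c • y) = c • (x * y) := by
  ext1 <;> simp [mul_def, smul_sub, smul_add]

@[simp] theorem oct_zero_mul (x : Octonion R) : 0 * x = 0 := by
  ext1 <;> simp [mul_def]

@[simp] theorem oct_mul_zero (x : Octonion R) : x * 0 = 0 := by
  ext1 <;> simp [mul_def]

theorem cayley_add (x y : Octonion R) : cayley (x + y) = cayley x + cayley y := by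
  ext1
  · simp [cayley]
  · simp [cayley]; abel

theorem cayley_smul (c : R) (x : Octonion R) : cayley (c • x) = c • cayley x := by
  ext1 <;> simp [cayley]

@[simp] theorem cayley_zero : cayley (0 : Octonion R) = 0 := by
  ext1 <;> simp [cayley]

@[simp] theorem cayley_cayley (x : Octonion R) : cayley (cayley x) = x := by
  ext1 <;> simp [cayley]

theorem bil_eq (x y : Octonion R) : bil x y =
    2 * (x.fst.re * y.fst.re + x.fst.imI * y.fst.imI + x.fst.imJ * y.fst.imJ
      + x.fst.imK * y.fst.imK + x.snd.re * y.snd.re + x.snd.imI * y.snd.imI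
      + x.snd.imJ * y.snd.imJ + x.snd.imK * y.snd.imK) := by
  simp [bil, n, Quaternion.normSq_def']
  ring

theorem bil_add_left (x y z : Octonion R) : bil (x + y) z = bil x z + bil y z := by
  simp [bil_eq]; ring

theorem bil_add_right (x y z : Octonion R) : bil x (y + z) = bil x y + bil x z := by
  simp [bil_eq]; ring

theorem bil_smul_left (c : R) (x y : Octonion R) : bil (c • x) y = c * bil x y := by
  simp [bil_eq]; ring

theorem bil_smul_right (c : R) (x y : Octonion R) : bil x (c • y) = c * bil x y := by
  simp [bil_eq]; ring

@[simp] theorem bil_zero_left (x : Octonion R) : bil 0 x = 0 := by simp [bil_eq]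

@[simp] theorem bil_zero_right (x : Octonion R) : bil x 0 = 0 := by simp [bil_eq]

theorem cconj_add (x y : Octonion ℂ) : cconj (x + y) = cconj x + cconj y := by
  ext <;> simp [cconj]

theorem cconj_smul (c : ℂ) (x : Octonion ℂ) : cconj (c • x) = conj c • cconj x := by
  ext <;> simp [cconj]

@[simp] theorem cconj_zero : cconj 0 = 0 := by
  ext <;> simp [cconj]

end Octonion

open Octonion

/-! ### The space of Hermitian 3 by 3 matrices over the complex octonions -/

/-- The space `H₃(𝕆)` of `3 × 3` matrices over the complex octonions that are Hermitian for the
Cayley conjugation `~`. With indices `1, 2, 3` written as `0, 1, 2`, an element `a` stands for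
```
  a.diag 0      a.off 2      ~(a.off 1)
  ~(a.off 2)    a.diag 1     a.off 0
  a.off 1       ~(a.off 0)   a.diag 2
```
-/
@[ext]
structure H3 where
  diag : Fin 3 → ℂ
  off : Fin 3 → Octonion ℂ

namespace H3

/-- An element of `H₃(𝕆)` as the pair of its diagonal and off-diagonal parts. -/
def equivProd : H3 ≃ (Fin 3 → ℂ) × (Fin 3 → Octonion ℂ) where
  toFun a := (a.diag, a.off)
  invFun p := ⟨p.1, p.2⟩
  left_inv _ := rfl
  right_inv _ := rfl

instance : AddCommGroup H3 := equivProd.addCommGroup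

instance : Module ℂ H3 := equivProd.module ℂ

@[simp] theorem diag_zero (i : Fin 3) : (0 : H3).diag i = 0 := rfl
@[simp] theorem off_zero (i : Fin 3) : (0 : H3).off i = 0 := rfl
@[simp] theorem diag_add (a b : H3) (i : Fin 3) : (a + b).diag i = a.diag i + b.diag i := rfl
@[simp] theorem off_add (a b : H3) (i : Fin 3) : (a + b).off i = a.off i + b.off i := rfl
@[simp] theorem diag_sub (a b : H3) (i : Fin 3) : (a - b).diag i = a.diag i - b.diag i := rfl
@[simp] theorem off_sub (a b : H3) (i : Fin 3) : (a - b).off i = a.off i - b.off i := rfl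
@[simp] theorem diag_smul (c : ℂ) (a : H3) (i : Fin 3) : (c • a).diag i = c * a.diag i := rfl
@[simp] theorem off_smul (c : ℂ) (a : H3) (i : Fin 3) : (c • a).off i = c • a.off i := rfl

/-- The matrix `F_i(x)`. -/
def F (i : Fin 3) : Octonion ℂ →ₗ[ℂ] H3 where
  toFun x := ⟨0, Pi.single i x⟩
  map_add' x y := by
    ext1
    · funext j; simp
    · funext j; by_cases h : j = i <;> simp [h]
  map_smul' c x := by
    ext1
    · funext j; simp
    · funext j; by_cases h : j = i <;> simp [h]

/-- The scalar product `(a : b)`, which is `ℂ`-bilinear. -/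
def bil (a b : H3) : ℂ := ∑ i, a.diag i * b.diag i + ∑ i, Octonion.bil (a.off i) (b.off i)

/-- The adjoint `a^#`; here `(i, i + 1, i + 2)` runs through the even permutations. -/
def adj (a : H3) : H3 where
  diag i := a.diag (i + 1) * a.diag (i + 2) - n (a.off i)
  off i := cayley (a.off (i + 1) * a.off (i + 2) - a.diag i • cayley (a.off i))

/-- The Freudenthal product `a × b`. -/
def frd (a b : H3) : H3 := adj (a + b) - adj a - adj b

/-- Complex conjugation with respect to `H₃(𝕆_c)`. -/
def cconj (a : H3) : H3 where
  diag i := conj (a.diag i)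
  off i := Octonion.cconj (a.off i)

/-- The Hermitian scalar product `(a | b)`, linear in `a` and antilinear in `b`. -/
def herm (a b : H3) : ℂ := bil a (cconj b)

theorem diag_frd (a b : H3) (i : Fin 3) : (frd a b).diag i =
    a.diag (i + 1) * b.diag (i + 2) + b.diag (i + 1) * a.diag (i + 2)
      - Octonion.bil (a.off i) (b.off i) := by
  simp [frd, adj, Octonion.bil]; ring

theorem off_frd (a b : H3) (i : Fin 3) : (frd a b).off i =
    cayley (a.off (i + 1) * b.off (i + 2)) + cayley (b.off (i + 1) * a.off (i + 2))
      - a.diag i • b.off i - b.diag i • a.off i := by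
  have hs (x y : Octonion ℂ) : cayley (x - y) = cayley x - cayley y := by
    ext1
    · simp [cayley]
    · simp [cayley]; abel
  simp only [frd, adj, off_sub, off_add, diag_add, oct_add_mul, oct_mul_add, cayley_add, hs,
    cayley_smul, cayley_cayley, smul_add, add_smul]
  abel

theorem frd_add_left (a b c : H3) : frd (a + b) c = frd a c + frd b c := by
  ext1 <;> funext i
  · simp [diag_frd, bil_add_left]; ring
  · simp only [off_frd, off_add, diag_add, oct_add_mul, oct_mul_add, cayley_add, smul_add, add_smul]
    abel

theorem frd_add_right (a b c : H3) : frd a (b + c) = frd a b + frd a c := by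
  ext1 <;> funext i
  · simp [diag_frd, bil_add_right]; ring
  · simp only [off_frd, off_add, diag_add, oct_add_mul, oct_mul_add, cayley_add, smul_add, add_smul]
    abel

theorem frd_smul_left (c : ℂ) (a b : H3) : frd (c • a) b = c • frd a b := by
  ext1 <;> funext i
  · simp [diag_frd, bil_smul_left]; ring
  · simp only [off_frd, off_smul, diag_smul, oct_smul_mul, oct_mul_smul, cayley_smul, smul_add,
      smul_sub, mul_smul]
    rw [smul_comm (b.diag i) c]

theorem frd_smul_right (c : ℂ) (a b : H3) : frd a (c • b) = c • frd a b := by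
  ext1 <;> funext i
  · simp [diag_frd, bil_smul_right]; ring
  · simp only [off_frd, off_smul, diag_smul, oct_smul_mul, oct_mul_smul, cayley_smul, smul_add,
      smul_sub, mul_smul]
    rw [smul_comm (a.diag i) c]

theorem cconj_add (a b : H3) : cconj (a + b) = cconj a + cconj b := by
  ext1 <;> funext i <;> simp [cconj, Octonion.cconj_add]

theorem cconj_smul (c : ℂ) (a : H3) : cconj (c • a) = conj c • cconj a := by
  ext1 <;> funext i <;> simp [cconj, Octonion.cconj_smul]

theorem herm_add_left (a b c : H3) : herm (a + b) c = herm a c + herm b c := by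
  simp only [herm, bil, diag_add, off_add, add_mul, bil_add_left, Finset.sum_add_distrib]; ring

theorem herm_add_right (a b c : H3) : herm a (b + c) = herm a b + herm a c := by
  simp only [herm, bil, cconj_add, diag_add, off_add, mul_add, bil_add_right,
    Finset.sum_add_distrib]; ring

theorem herm_smul_left (c : ℂ) (a b : H3) : herm (c • a) b = c * herm a b := by
  simp only [herm, bil, diag_smul, off_smul, bil_smul_left, Finset.mul_sum, mul_add, mul_assoc]

theorem herm_smul_right (c : ℂ) (a b : H3) : herm a (c • b) = conj c * herm a b := by
  simp only [herm, bil, cconj_smul, diag_smul, off_smul, bil_smul_right, Finset.mul_sum, mul_add,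
    mul_left_comm]

end H3

/-! ### Hermitian Jordan triple systems -/

/-- A triple product `{x y z}`, `ℂ`-linear in `x` and `z`, antilinear in `y`; `T x y z` is
`{x y z}` and `T x y` is the linear operator `D(x, y)`. -/
abbrev TripleProduct (V : Type) [AddCommGroup V] [Module ℂ V] :=
  V →ₗ[ℂ] V →ₗ⋆[ℂ] V →ₗ[ℂ] V

namespace TripleProduct

variable {V : Type} [AddCommGroup V] [Module ℂ V] (T : TripleProduct V)

/-- The operator `D(x, y) : z ↦ {x y z}`. -/
def D (x y : V) : V →ₗ[ℂ] V := T x y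

/-- The antilinear operator `Q(x) : y ↦ (1 / 2) {x y x}`. -/
def Q (x : V) : V →ₗ⋆[ℂ] V where
  toFun y := (1 / 2 : ℂ) • T x y x
  map_add' y z := by simp
  map_smul' c y := by
    rw [map_smulₛₗ, LinearMap.smul_apply]
    exact smul_comm _ _ _

/-- The Bergman operator `B(x, y) = I - D(x, y) + Q(x) Q(y)`. -/
def B (x y : V) : V →ₗ[ℂ] V := LinearMap.id - T.D x y + (T.Q x).comp (T.Q y)

/-- `T` makes `V` a Hermitian Jordan triple system: `{x y z}` is symmetric in `x` and `z`, and
the two Jordan identities hold. -/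
structure IsHermitianJTS : Prop where
  symm : ∀ x y z, T x y z = T z y x
  jordan₁ : ∀ x y u, T.D x y (T.Q x u) = T.Q x (T.D y x u)
  jordan₂ : ∀ x y, T.D (T.Q x y) y = T.D x (T.Q y x)

/-- Positivity: if `x ≠ 0` and `x^(3) = c x`, where `x^(3) = (1 / 2) {x x x}`, then `c` is real and
positive. -/
def IsPositive : Prop :=
  ∀ (x : V) (c : ℂ), x ≠ 0 → T.Q x x = c • x → c.im = 0 ∧ 0 < c.re

/-- The trace form `(x, y) ↦ Tr D(x, y)` is Hermitian and positive definite. -/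
def TraceFormPosDef : Prop :=
  (∀ x y, LinearMap.trace ℂ V (T.D y x) = conj (LinearMap.trace ℂ V (T.D x y))) ∧
    ∀ x, x ≠ 0 → 0 < (LinearMap.trace ℂ V (T.D x x)).re

/-- A subspace `I` is an ideal if `{x y z} ∈ I` as soon as one of `x`, `y`, `z` is in `I`. -/
def IsIdeal (I : Submodule ℂ V) : Prop :=
  ∀ u ∈ I, ∀ x y, T u x y ∈ I ∧ T x u y ∈ I ∧ T x y u ∈ I

/-- Simplicity: the product is not zero and there are no ideals except `0` and `V`. -/
def IsSimple : Prop :=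
  (∃ x y z, T x y z ≠ 0) ∧ ∀ I : Submodule ℂ V, T.IsIdeal I → I = ⊥ ∨ I = ⊤

/-- `T.pow x y k` is the power `x^(k+1, y)`: `x^(1, y) = x`,
`x^(k+1, y) = (1 / 2) D(x, y) x^(k, y)`. -/
def pow (x y : V) : ℕ → V
  | 0 => x
  | k + 1 => (1 / 2 : ℂ) • T.D x y (pow x y k)

/-- The rank is `r`, the degree of the generic minimal polynomial: `r` is the largest dimension of
a space spanned by the powers `x^(k, y)`, `k ≥ 1`, for `x`, `y` in `V`. -/
def HasRank (r : ℕ) : Prop :=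
  IsGreatest {d : ℕ | ∃ x y : V, d = Module.finrank ℂ (Submodule.span ℂ (Set.range (T.pow x y)))} r

/-- A tripotent is an element with `x^(3) = x`. -/
def IsTripotent (x : V) : Prop := T.Q x x = x

/-- Two tripotents `x`, `y` are orthogonal if `D(x, y) = 0`. -/
def Orthogonal (x y : V) : Prop := T.D x y = 0

/-- A tripotent is minimal if it is not zero and not the sum of two orthogonal non-zero
tripotents. -/
def IsMinimalTripotent (x : V) : Prop :=
  T.IsTripotent x ∧ x ≠ 0 ∧
    ∀ y z, T.IsTripotent y → T.IsTripotent z → T.Orthogonal y z → x = y + z → y = 0 ∨ z = 0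

/-- A finite sequence of pairwise orthogonal minimal tripotents. -/
def IsOrthogonalSystem {m : ℕ} (e : Fin m → V) : Prop :=
  (∀ i, T.IsMinimalTripotent (e i)) ∧ ∀ i j, i ≠ j → T.Orthogonal (e i) (e j)

/-- A tripotent has rank `k` if it is the sum of `k` pairwise orthogonal minimal tripotents. -/
def IsTripotentOfRank (k : ℕ) (x : V) : Prop :=
  T.IsTripotent x ∧ ∃ e : Fin k → V, T.IsOrthogonalSystem e ∧ x = ∑ i, e i

/-- A frame is a maximal system of pairwise orthogonal minimal tripotents. -/
def IsFrame {m : ℕ} (e : Fin m → V) : Prop :=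
  T.IsOrthogonalSystem e ∧
    ∀ f, T.IsMinimalTripotent f → ¬ ∀ i, T.Orthogonal (e i) f ∧ T.Orthogonal f (e i)

/-- The space `V_ij` of the simultaneous Peirce decomposition relative to `e`, that is
`{z | D(e_k, e_k) z = (δ_ik + δ_jk) z for all k}`. The index `0` of `V_0i`, which belongs to no
element of `e`, is `none`. -/
def peirce {m : ℕ} (e : Fin m → V) (i j : Option (Fin m)) : Submodule ℂ V :=
  ⨅ k : Fin m, LinearMap.ker
    (T.D (e k) (e k) -
      ((if i = some k then 1 else 0) + (if j = some k then 1 else 0) : ℂ) • LinearMap.id)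

/-- The numerical invariants of a simple positive Hermitian Jordan triple system: the rank is `r`;
frames exist, and each frame has `r` elements, `dim V_ij = a` for `1 ≤ i < j ≤ r` and
`dim V_0i = b` for `1 ≤ i ≤ r`; the genus is `g = 2 + a (r - 1) + b`. -/
structure HasInvariants (a b r g : ℕ) : Prop where
  rank : T.HasRank r
  exists_frame : ∃ e : Fin r → V, T.IsFrame e
  length_frame : ∀ (m : ℕ) (e : Fin m → V), T.IsFrame e → m = r
  dim_a : ∀ e : Fin r → V, T.IsFrame e → ∀ i j : Fin r, i < j →
    Module.finrank ℂ (T.peirce e (some i) (some j)) = a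
  dim_b : ∀ e : Fin r → V, T.IsFrame e → ∀ i : Fin r,
    Module.finrank ℂ (T.peirce e none (some i)) = b
  genus : (g : ℤ) = 2 + a * (r - 1) + b

/-- The triple product of a subsystem, that is, of a subspace closed under the triple product. -/
def restrict (W : Submodule ℂ V) (h : ∀ x ∈ W, ∀ y ∈ W, ∀ z ∈ W, T x y z ∈ W) :
    TripleProduct W where
  toFun x :=
    { toFun := fun y => (T x y).restrict fun z hz => h x x.2 y y.2 z hz
      map_add' := fun y y' => by ext z; simp
      map_smul' := fun c y => by ext z; simp }
  map_add' x x' := by ext y z; simp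
  map_smul' c x := by ext y z; simp

end TripleProduct

/-! ### The exceptional triple systems of dimension 27 and 16 -/

/-- The triple product `{x y z} = (x | y) z + (z | y) x - (x × z) × ȳ` on `H₃(𝕆)`. -/
def H3.triple : TripleProduct H3 where
  toFun x :=
    { toFun := fun y =>
        { toFun := fun z => H3.herm x y • z + H3.herm z y • x - H3.frd (H3.frd x z) (H3.cconj y)
          map_add' := fun z z' => by
            simp only [H3.herm_add_left, H3.frd_add_left, H3.frd_add_right, smul_add, add_smul]
            abel
          map_smul' := fun c z => by
            simp only [H3.herm_smul_left, H3.frd_smul_left, H3.frd_smul_right, smul_add, smul_sub,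
              mul_smul, RingHom.id_apply]
            rw [smul_comm c (H3.herm x y)] }
      map_add' := fun y y' => by
        ext1 z
        simp only [H3.herm_add_right, H3.cconj_add, H3.frd_add_right, add_smul,
          LinearMap.coe_mk, AddHom.coe_mk, LinearMap.add_apply]
        abel
      map_smul' := fun c y => by
        ext1 z
        simp only [H3.herm_smul_right, H3.cconj_smul, H3.frd_smul_right, smul_add, smul_sub,
          mul_smul, LinearMap.coe_mk, AddHom.coe_mk, LinearMap.smul_apply] }
  map_add' x x' := by
    ext1 y; ext1 z
    simp only [H3.herm_add_left, H3.frd_add_left, add_smul, smul_add,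
      LinearMap.coe_mk, AddHom.coe_mk, LinearMap.add_apply]
    abel
  map_smul' c x := by
    ext1 y; ext1 z
    simp only [H3.herm_smul_left, H3.frd_smul_left, smul_add, smul_sub, mul_smul,
      LinearMap.coe_mk, AddHom.coe_mk, LinearMap.smul_apply, RingHom.id_apply]
    rw [smul_comm (H3.herm z y) c]

/-- The subspace `W = 𝓕₂ ⊕ 𝓕₃` of `H₃(𝕆)`. -/
def W : Submodule ℂ H3 := LinearMap.range (H3.F 1) ⊔ LinearMap.range (H3.F 2)

theorem mem_W {x : H3} : x ∈ W ↔ x.diag = 0 ∧ x.off 0 = 0 := by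
  constructor
  · intro hx
    obtain ⟨_, ⟨p, rfl⟩, _, ⟨q, rfl⟩, rfl⟩ := Submodule.mem_sup.1 hx
    refine ⟨?_, ?_⟩
    · funext i; simp [H3.F]
    · simp [H3.F]
  · rintro ⟨h₁, h₂⟩
    refine Submodule.mem_sup.2 ⟨H3.F 1 (x.off 1), ⟨_, rfl⟩, H3.F 2 (x.off 2), ⟨_, rfl⟩, ?_⟩
    ext1 <;> funext i
    · simp [H3.F, h₁]
    · fin_cases i <;> simp [H3.F, h₂]

theorem W_closed : ∀ x ∈ W, ∀ y ∈ W, ∀ z ∈ W, H3.triple x y z ∈ W := by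
  intro x hx y hy z hz
  rw [mem_W] at hx hy hz
  obtain ⟨hx₁, hx₂⟩ := hx
  obtain ⟨hy₁, hy₂⟩ := hy
  obtain ⟨hz₁, hz₂⟩ := hz
  have key : H3.frd (H3.frd x z) (H3.cconj y) ∈ W := by
    rw [mem_W]
    constructor
    · funext i
      fin_cases i <;>
        simp [H3.diag_frd, H3.off_frd, H3.cconj, hx₁, hx₂, hy₁, hy₂, hz₁, hz₂]
    · simp [H3.diag_frd, H3.off_frd, H3.cconj, hx₁, hx₂, hy₁, hy₂, hz₁, hz₂]
  have hx : x ∈ W := mem_W.2 ⟨hx₁, hx₂⟩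
  have hz : z ∈ W := mem_W.2 ⟨hz₁, hz₂⟩
  exact W.sub_mem (W.add_mem (W.smul_mem _ hz) (W.smul_mem _ hx)) key

/-- The triple product of the subsystem `W`. -/
def tripleW : TripleProduct W := H3.triple.restrict W W_closed

end ExceptionalJTS

end

open scoped ComplexConjugate Quaternion

noncomputable section

namespace ExceptionalJTS

/-! ### Composition and alternative laws in the Cayley algebra. -/

namespace Octonion
variable {R : Type} [CommRing R]

/-! The two off-diagonal entries identify `W` with pairs of octonions (`coordW`). Under this
identification `{x y z}` is `trip x ȳ z`, where `trip` is linear in all three arguments (a Jordan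
pair). The adjoint becomes `sharp`, with values in a ten-dimensional quadratic space that acts on
pairs by `act`, as in a half-spin representation. Complex conjugation thus plays no part in the
algebraic identities.

The Jordan pair has many automorphisms: `transvection` and `swap` move any `x` to an element with
zero first component (`exists_isAutomorphism`), where `quad` is that of a spin factor
(`quad_of_fst`). This reduces to short computations the Jordan identities, the quadratic equation
`trip_quad_left` satisfied by the powers of `x`, and the determinant of the Bergman operator, which
becomes block triangular with blocks of determinant `p ^ 4` and `p ^ 8`. The trace of `D(x, y)` is
read off from the diagonal blocks.

For the tripotents put `r = (x | x)` and `m = (x^# | x^#)`. If `Q(x)x = x ≠ 0`, then `triple_Q`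
gives `r - m = 1` and `herm_Q_self` gives `r = r² - 2m`, so `(r, m)` is `(1, 0)` or `(2, 1)`; the
converse is a computation of lengths. An element `c` of the first type satisfies `Q(c)z = (c | z)c`,
hence is minimal. An element `x` of the second type splits as the sum of `(x ± ie)/2`, where `Q(x)e
= -e` (`exists_eq_add`). So minimal means `r = 1`, and three orthogonal minimal tripotents are
impossible because `r` would be `3`.

Dimensions of Peirce spaces are traces of projections built from `D(c, c)`, of trace `12`, and `Q(c
+ d)²`, of trace `8`: the kernel of `D(c, c)` has dimension `16 + 1 - 12 = 5`, and `a = 8 - 1 - 1`,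
`b = 12 - 8 - 1 + 1`. Simplicity follows: a proper ideal lies in some 5-dimensional kernel of `D(c,
c)`, while a non-zero one contains the 11-dimensional range of some `D(d, d)`. -/

instance : NonUnitalNonAssocRing (Octonion R) where
  left_distrib := oct_mul_add
  right_distrib := oct_add_mul
  zero_mul := oct_zero_mul
  mul_zero := oct_mul_zero

instance : IsScalarTower R (Octonion R) (Octonion R) := ⟨oct_smul_mul⟩

instance : SMulCommClass R (Octonion R) (Octonion R) := ⟨fun c x y => (oct_mul_smul c x y).symm⟩

/-- The Cayley conjugation as a linear map. -/
def cayleyₗ : Octonion R →ₗ[R] Octonion R where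
  toFun := cayley
  map_add' := cayley_add
  map_smul' := cayley_smul

theorem cayley_sub (x y : Octonion R) : cayley (x - y) = cayley x - cayley y := cayleyₗ.map_sub x y

theorem cayley_mul (x y : Octonion R) : cayley (x * y) = cayley y * cayley x := by
  ext <;> simp [cayley, mul_def]

theorem cayley_mul_mul_self (x y : Octonion R) : cayley x * (x * y) = n x • y := by
  ext <;> simp [cayley, mul_def, n, Quaternion.normSq_def'] <;> ring

theorem mul_mul_cayley_self (x y : Octonion R) : (x * y) * cayley y = n y • x := by
  ext <;> simp [cayley, mul_def, n, Quaternion.normSq_def'] <;> ring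

@[simp] theorem n_cayley (x : Octonion R) : n (cayley x) = n x := by
  simp [n, cayley, Quaternion.normSq_def']

@[simp] theorem n_smul (c : R) (x : Octonion R) : n (c • x) = c ^ 2 * n x := by
  simp [n, Quaternion.normSq_def']; ring

theorem n_mul (x y : Octonion R) : n (x * y) = n x * n y := by
  simp [n, mul_def, Quaternion.normSq_def']; ring

theorem n_add (x y : Octonion R) : n (x + y) = n x + n y + bil x y := by
  simp [bil]

theorem bil_comm (x y : Octonion R) : bil x y = bil y x := by
  simp [bil_eq]; ring

theorem bil_self (x : Octonion R) : bil x x = 2 * n x := by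
  simp [bil_eq, n, Quaternion.normSq_def']; ring

theorem bil_cayley (x y : Octonion R) : bil (cayley x) y = bil x (cayley y) := by
  simp [bil_eq, cayley]

theorem bil_mul_left (x y z : Octonion R) : bil (x * y) z = bil y (cayley x * z) := by
  simp [bil_eq, cayley, mul_def]; ring

theorem bil_mul_right (x y z : Octonion R) : bil (x * y) z = bil x (z * cayley y) := by
  simp [bil_eq, cayley, mul_def]; ring

theorem mul_cayley_mul_self (x y : Octonion R) : x * (cayley x * y) = n x • y := by
  simpa using cayley_mul_mul_self (cayley x) y

theorem mul_cayley_mul (x y : Octonion R) : (x * cayley y) * y = n y • x := by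
  simpa using mul_mul_cayley_self x (cayley y)

/-- This is the full polarisation of `n (a * b) = n a * n b`; the five instances isolate the part
that is linear in each of the four variables. -/
theorem bil_mul_mul_add (p x z w : Octonion R) :
    bil (p * x) (z * w) + bil (z * x) (p * w) = bil p z * bil x w := by
  have h₁ := n_mul (p + z) (x + w)
  have h₂ := n_mul (p + z) x
  have h₃ := n_mul (p + z) w
  have h₄ := n_mul p (x + w)
  have h₅ := n_mul z (x + w)
  simp only [add_mul, mul_add, n_add, n_mul, bil_add_left, bil_add_right] at h₁ h₂ h₃ h₄ h₅
  linear_combination h₁ - h₂ - h₃ - h₄ - h₅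

theorem cayley_mul_mul_add (x y z : Octonion R) :
    cayley x * (z * y) + cayley z * (x * y) = bil x z • y := by
  have h := cayley_mul_mul_self (x + z) y
  simp only [n_add, add_mul, mul_add, cayley_add, add_smul, cayley_mul_mul_self] at h
  linear_combination (norm := module) h

theorem mul_cayley_mul_add (x y z : Octonion R) :
    x * (cayley z * y) + z * (cayley x * y) = bil x z • y := by
  simpa [bil_cayley] using cayley_mul_mul_add (cayley x) y (cayley z)

theorem mul_mul_cayley_add (x y z : Octonion R) :
    (x * y) * cayley z + (x * z) * cayley y = bil y z • x := by
  have h := mul_mul_cayley_self x (y + z)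
  simp only [n_add, add_mul, mul_add, cayley_add, add_smul, mul_mul_cayley_self] at h
  linear_combination (norm := module) h

theorem mul_mul_cayley_add' (x y z : Octonion R) :
    (x * cayley y) * z + (x * cayley z) * y = bil y z • x := by
  simpa [bil_cayley] using mul_mul_cayley_add x (cayley y) (cayley z)

/-- The coordinates of an octonion. -/
def coords (R : Type) [CommRing R] : Octonion R ≃ₗ[R] (Fin 8 → R) where
  toFun x := ![x.fst.re, x.fst.imI, x.fst.imJ, x.fst.imK, x.snd.re, x.snd.imI, x.snd.imJ, x.snd.imK]
  map_add' x y := by ext i; fin_cases i <;> rfl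
  map_smul' c x := by ext i; fin_cases i <;> rfl
  invFun v := ⟨⟨v 0, v 1, v 2, v 3⟩, ⟨v 4, v 5, v 6, v 7⟩⟩
  left_inv _ := rfl
  right_inv v := by ext i; fin_cases i <;> rfl

theorem coords_apply (x : Octonion R) : coords R x = ![x.fst.re, x.fst.imI, x.fst.imJ, x.fst.imK,
    x.snd.re, x.snd.imI, x.snd.imJ, x.snd.imK] := rfl

theorem coords_symm_apply (v : Fin 8 → R) :
    (coords R).symm v = ⟨⟨v 0, v 1, v 2, v 3⟩, ⟨v 4, v 5, v 6, v 7⟩⟩ := rfl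

/-- The basis of eight orthogonal units. -/
def basis (R : Type) [CommRing R] : Module.Basis (Fin 8) R (Octonion R) :=
  .ofEquivFun (coords R)

theorem bil_basis (x : Octonion R) (i : Fin 8) :
    bil (basis R i) x = 2 * (basis R).repr x i := by
  rw [bil_eq, basis, Module.Basis.coe_ofEquivFun]
  fin_cases i <;> simp [coords_apply, coords_symm_apply]

theorem bil_eq_sum (x y : Octonion R) :
    bil x y = 2 * ∑ i, (basis R).repr x i * (basis R).repr y i := by
  simp [Fin.sum_univ_eight, basis, coords_apply, bil_eq]

instance : Module.Free R (Octonion R) := .of_basis (basis R)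

instance : Module.Finite R (Octonion R) := .of_basis (basis R)

theorem eq_of_bil_eq {x y : Octonion ℂ} (h : ∀ z, bil x z = bil y z) : x = y := by
  refine (basis ℂ).repr.injective (Finsupp.ext fun i => ?_)
  have h' := h (basis ℂ i)
  rw [bil_comm, bil_basis, bil_comm y, bil_basis] at h'
  exact mul_left_cancel₀ two_ne_zero h'

/-- Paired with an arbitrary `z`, this is `bil_mul_mul_add` with `w = p~ y~`, since `p (p~ y~) =
n(p) y~`. -/
theorem middle_moufang (p x y : Octonion ℂ) :
    (p * x) * (y * p) = bil p (cayley (x * y)) • p - n p • cayley (x * y) := by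
  refine eq_of_bil_eq fun z => ?_
  rw [bil_mul_right, cayley_mul, sub_eq_add_neg, ← neg_smul, bil_add_left, bil_smul_left,
    bil_smul_left]
  have h₁ := bil_mul_mul_add p x z (cayley p * cayley y)
  have h₂ : bil x (cayley p * cayley y) = bil p (cayley (x * y)) := by
    rw [bil_comm, bil_mul_left, cayley_cayley, bil_comm, bil_mul_right, cayley_mul]
  have h₃ : bil (z * x) (cayley y) = bil (cayley (x * y)) z := by
    rw [bil_mul_right, bil_comm, cayley_mul]
  rw [mul_cayley_mul_self, bil_smul_right, h₂, h₃] at h₁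
  linear_combination h₁

/-! ### Complex conjugation -/

theorem cconj_mul (x y : Octonion ℂ) : cconj (x * y) = cconj x * cconj y := by
  ext <;> simp [cconj, mul_def]

theorem cconj_cayley (x : Octonion ℂ) : cconj (cayley x) = cayley (cconj x) := by
  ext <;> simp [cconj, cayley]

@[simp] theorem cconj_cconj (x : Octonion ℂ) : cconj (cconj x) = x := by
  ext <;> simp [cconj]

theorem n_cconj (x : Octonion ℂ) : n (cconj x) = conj (n x) := by
  simp [n, cconj, Quaternion.normSq_def']

theorem bil_cconj (x y : Octonion ℂ) : bil (cconj x) (cconj y) = conj (bil x y) := by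
  simp [bil, ← cconj_add, n_cconj]

theorem repr_cconj (x : Octonion ℂ) (i : Fin 8) :
    (basis ℂ).repr (cconj x) i = conj ((basis ℂ).repr x i) := by
  fin_cases i <;> simp [basis, coords_apply, cconj]

theorem bil_cconj_self (x : Octonion ℂ) :
    bil x (cconj x) = ((2 * ∑ i, Complex.normSq ((basis ℂ).repr x i) : ℝ) : ℂ) := by
  simp [bil_eq_sum, repr_cconj, Complex.mul_conj]

theorem bil_cconj_self_re_nonneg (x : Octonion ℂ) : 0 ≤ (bil x (cconj x)).re := by
  rw [bil_cconj_self, Complex.ofReal_re]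
  exact mul_nonneg zero_le_two (Finset.sum_nonneg fun i _ => Complex.normSq_nonneg _)

theorem eq_zero_of_bil_cconj_self {x : Octonion ℂ} (h : (bil x (cconj x)).re = 0) : x = 0 := by
  rw [bil_cconj_self, Complex.ofReal_re, mul_eq_zero, or_iff_right two_ne_zero,
    Finset.sum_eq_zero_iff_of_nonneg fun i _ => Complex.normSq_nonneg _] at h
  refine (basis ℂ).repr.injective (Finsupp.ext fun i => ?_)
  simpa using h i (Finset.mem_univ i)

end Octonion

/-! ### Traces and determinants of operators on the octonions. -/

namespace Octonion

open LinearMap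

theorem finrank_octonion : Module.finrank ℂ (Octonion ℂ) = 8 := by
  simpa using Module.finrank_eq_card_basis (basis ℂ)

/-- The basis units are orthogonal and all of the same norm, so passing to the adjoint transposes
the matrix. -/
theorem toMatrix_transpose_of_adjoint {f g : Octonion ℂ →ₗ[ℂ] Octonion ℂ}
    (h : ∀ x y, bil (f x) y = bil x (g y)) :
    (toMatrix (basis ℂ) (basis ℂ) f).transpose = toMatrix (basis ℂ) (basis ℂ) g := by
  ext i j
  have h' := h (basis ℂ i) (basis ℂ j)
  rw [bil_comm, bil_basis, bil_basis] at h'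
  rw [Matrix.transpose_apply, toMatrix_apply, toMatrix_apply]
  exact mul_left_cancel₀ two_ne_zero h'

/-- A quadratic operator that is adjoint to its conjugate has a power of its quadratic equation as
characteristic polynomial. -/
theorem charpoly_of_quadratic {f g : Octonion ℂ →ₗ[ℂ] Octonion ℂ} {s m : ℂ}
    (h : ∀ x y, bil (f x) y = bil x (g y)) (hs : ∀ x, f x + g x = s • x)
    (hm : ∀ x, f (f x) = s • f x - m • x) :
    f.charpoly = (Polynomial.X ^ 2 - Polynomial.C s * Polynomial.X + Polynomial.C m) ^ 4 := by
  have hg : g.charpoly = f.charpoly := by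
    rw [← charpoly_toMatrix f (basis ℂ), ← charpoly_toMatrix g (basis ℂ),
      ← toMatrix_transpose_of_adjoint h, Matrix.charpoly_transpose]
  have hsq : f.charpoly ^ 2 =
      ((Polynomial.X ^ 2 - Polynomial.C s * Polynomial.X + Polynomial.C m) ^ 4) ^ 2 := by
    -- At `t` the square is `det (t - f) * det (t - g)`, and `(t - f)(t - g)` is the scalar `t² - st
    -- + m` on an eight-dimensional space.
    refine Polynomial.funext fun t => ?_
    rw [sq, Polynomial.eval_mul]
    nth_rw 2 [← hg]
    rw [eval_charpoly, eval_charpoly, ← LinearMap.det_comp]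
    have : (algebraMap ℂ (Module.End ℂ (Octonion ℂ)) t - f) ∘ₗ
        (algebraMap ℂ (Module.End ℂ (Octonion ℂ)) t - g) = (t ^ 2 - s * t + m) • LinearMap.id := by
      ext1 x
      have h₁ : g x = s • x - f x := by rw [← hs x]; abel
      simp only [comp_apply, LinearMap.sub_apply, Module.algebraMap_end_apply, map_sub, map_smul, h₁,
        LinearMap.smul_apply, id_apply, hm]
      module
    rw [this, LinearMap.det_smul, LinearMap.det_id, finrank_octonion]
    simp
    ring
  -- The square root is determined up to sign, and the sign is fixed because both polynomials are
  -- monic.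
  rcases sq_eq_sq_iff_eq_or_eq_neg.1 hsq with h' | h'
  · exact h'
  · have h₁ : (Polynomial.X ^ 2 - Polynomial.C s * Polynomial.X + Polynomial.C m : Polynomial ℂ).Monic := by
      monicity!
    have h₂ := f.charpoly_monic.leadingCoeff
    rw [h', Polynomial.leadingCoeff_neg, (h₁.pow 4).leadingCoeff] at h₂
    norm_num at h₂

theorem det_one_sub_of_quadratic {f g : Octonion ℂ →ₗ[ℂ] Octonion ℂ} {s m : ℂ}
    (h : ∀ x y, bil (f x) y = bil x (g y)) (hs : ∀ x, f x + g x = s • x)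
    (hm : ∀ x, f (f x) = s • f x - m • x) :
    LinearMap.det (1 - f) = (1 - s + m) ^ 4 := by
  have h' := congrArg (Polynomial.eval 1) (charpoly_of_quadratic h hs hm)
  rw [eval_charpoly, map_one] at h'
  simpa using h'

theorem trace_of_adjoint {f g : Octonion ℂ →ₗ[ℂ] Octonion ℂ} {s : ℂ}
    (h : ∀ x y, bil (f x) y = bil x (g y)) (hs : ∀ x, f x + g x = s • x) :
    LinearMap.trace ℂ _ f = 4 * s := by
  have h₁ : LinearMap.trace ℂ _ g = LinearMap.trace ℂ _ f := by
    rw [trace_eq_matrix_trace ℂ (basis ℂ) f, trace_eq_matrix_trace ℂ (basis ℂ) g,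
      ← toMatrix_transpose_of_adjoint h, Matrix.trace_transpose]
  have h₂ : f + g = s • LinearMap.id := LinearMap.ext hs
  have h₃ := congrArg (LinearMap.trace ℂ _) h₂
  rw [map_add, h₁, map_smul, trace_id, finrank_octonion] at h₃
  simp only [smul_eq_mul] at h₃
  push_cast at h₃
  linear_combination h₃ / 2

/-- The operator `x ↦ (x b) c~`. -/
def rightOp (b c : Octonion ℂ) : Octonion ℂ →ₗ[ℂ] Octonion ℂ :=
  mulRight ℂ (cayley c) ∘ₗ mulRight ℂ b

/-- The operator `x ↦ c~ (b x)`. -/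
def leftOp (b c : Octonion ℂ) : Octonion ℂ →ₗ[ℂ] Octonion ℂ :=
  mulLeft ℂ (cayley c) ∘ₗ mulLeft ℂ b

@[simp] theorem rightOp_apply (b c x : Octonion ℂ) : rightOp b c x = (x * b) * cayley c := rfl

@[simp] theorem leftOp_apply (b c x : Octonion ℂ) : leftOp b c x = cayley c * (b * x) := rfl

theorem bil_rightOp (b c x y : Octonion ℂ) : bil (rightOp b c x) y = bil x (rightOp c b y) := by
  simp [bil_mul_right]

theorem bil_leftOp (b c x y : Octonion ℂ) : bil (leftOp b c x) y = bil x (leftOp c b y) := by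
  simp [bil_mul_left]

theorem rightOp_add (b c x : Octonion ℂ) : rightOp b c x + rightOp c b x = bil b c • x := by
  simp [mul_mul_cayley_add]

theorem leftOp_add (b c x : Octonion ℂ) : leftOp b c x + leftOp c b x = bil b c • x := by
  simp only [leftOp_apply]
  rw [bil_comm, cayley_mul_mul_add]

theorem rightOp_rightOp (b c x : Octonion ℂ) :
    rightOp b c (rightOp b c x) = bil b c • rightOp b c x - (n b * n c) • x := by
  simp only [rightOp_apply]
  have h := mul_mul_cayley_add' (x * b) b c
  rw [show (x * b * cayley c) * b = bil b c • (x * b) - (x * b * cayley b) * c by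
    rw [← h]; abel, mul_mul_cayley_self, sub_mul, smul_mul_assoc, smul_mul_assoc, smul_mul_assoc,
    mul_mul_cayley_self, smul_smul]

theorem trace_rightOp (b c : Octonion ℂ) : LinearMap.trace ℂ _ (rightOp b c) = 4 * bil b c :=
  trace_of_adjoint (bil_rightOp b c) (rightOp_add b c)

theorem trace_leftOp (b c : Octonion ℂ) : LinearMap.trace ℂ _ (leftOp b c) = 4 * bil b c :=
  trace_of_adjoint (bil_leftOp b c) (leftOp_add b c)

theorem det_one_sub_rightOp (b c : Octonion ℂ) :
    LinearMap.det (1 - rightOp b c) = (1 - bil b c + n b * n c) ^ 4 :=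
  det_one_sub_of_quadratic (bil_rightOp b c) (rightOp_add b c) (rightOp_rightOp b c)

theorem det_smul_id_add_smulRight_add_smulRight (t : ℂ) (φ ψ : Octonion ℂ →ₗ[ℂ] ℂ)
    (u v : Octonion ℂ) :
    LinearMap.det (t • LinearMap.id + φ.smulRight u + ψ.smulRight v) =
      t ^ 6 * ((t + φ u) * (t + ψ v) - φ v * ψ u) := by
  let A : Matrix (Fin 8) (Fin 2) ℂ := Matrix.of fun i => ![-(basis ℂ).repr u i, -(basis ℂ).repr v i]
  let B : Matrix (Fin 2) (Fin 8) ℂ := Matrix.of ![fun j => φ (basis ℂ j), fun j => ψ (basis ℂ j)]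
  have hdual (χ : Octonion ℂ →ₗ[ℂ] ℂ) (w : Octonion ℂ) :
      ∑ i, χ (basis ℂ i) * (basis ℂ).repr w i = χ w := by
    conv_rhs => rw [← (basis ℂ).sum_repr w]
    simp only [map_sum, map_smul, smul_eq_mul, mul_comm]
  have hAB : toMatrix (basis ℂ) (basis ℂ) (t • LinearMap.id + φ.smulRight u + ψ.smulRight v) =
      Matrix.scalar (Fin 8) t - A * B := by
    ext i j
    simp [A, B, toMatrix_apply, Matrix.mul_apply, Fin.sum_univ_two,
      Matrix.diagonal_apply, Finsupp.single_apply, eq_comm (a := i)]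
    ring
  have hBA : B * A = !![-φ u, -φ v; -ψ u, -ψ v] := by
    ext i j
    fin_cases i <;> fin_cases j <;> simp [A, B, Matrix.mul_apply, hdual]
  -- The characteristic polynomials of `A * B` (size 8) and `B * A` (size 2) differ by the factor `X
  -- ^ 6`.
  rw [← LinearMap.det_toMatrix (basis ℂ), hAB, ← Matrix.eval_charpoly,
    Matrix.charpoly_mul_comm_of_le _ _ (by simp), hBA, Polynomial.eval_mul, Matrix.eval_charpoly,
    Matrix.det_fin_two]
  simp

/-- The Bergman operator of the triple system `x y~ x` on the octonions. -/
theorem det_bergman (b d : Octonion ℂ) (f : Octonion ℂ →ₗ[ℂ] Octonion ℂ)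
    (hf : ∀ v, f v = (1 - bil b d + n b * n d) • v +
      ((bil b d - 1) * bil d v - n d * bil b v) • b + (bil b v - n b * bil d v) • d) :
    LinearMap.det f = (1 - bil b d + n b * n d) ^ 8 := by
  let β (x : Octonion ℂ) : Octonion ℂ →ₗ[ℂ] ℂ :=
    { toFun := bil x, map_add' := bil_add_right x, map_smul' := fun c y => bil_smul_right c x y }
  have h : f = (1 - bil b d + n b * n d) • LinearMap.id
      + ((bil b d - 1) • β d - n d • β b).smulRight b + (β b - n b • β d).smulRight d := by
    ext1 v
    simp [hf, β]
  -- With `t = 1 - (b : d) + n(b) n(d)` the remaining 2 by 2 determinant equals `t ^ 2`.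
  rw [h, det_smul_id_add_smulRight_add_smulRight]
  simp only [β, LinearMap.sub_apply, LinearMap.smul_apply, LinearMap.coe_mk, AddHom.coe_mk, smul_eq_mul, bil_self]
  rw [bil_comm d b]
  ring

end Octonion

open Octonion

/-! ### The Jordan pair of pairs of octonions -/

/-- Pairs of octonions, the coordinate space of `W`. -/
abbrev OctPair := Octonion ℂ × Octonion ℂ

/-- The space in which the adjoints of pairs of octonions live. -/
abbrev OctSharp := ℂ × ℂ × Octonion ℂ

namespace OctPair

/-- The bilinear form of pairs. -/
def form (x y : OctPair) : ℂ := bil x.1 y.1 + bil x.2 y.2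

/-- The adjoint of a pair. -/
def sharp (x : OctPair) : OctSharp := (n x.1, n x.2, x.1 * x.2)

/-- The polarisation of the adjoint. -/
def cross (x y : OctPair) : OctSharp := (bil x.1 y.1, bil x.2 y.2, x.1 * y.2 + y.1 * x.2)

/-- The bilinear form on the space of adjoints. -/
def sharpForm (s t : OctSharp) : ℂ := s.1 * t.1 + s.2.1 * t.2.1 + bil s.2.2 t.2.2

/-- The action of the space of adjoints on pairs. -/
def act (s : OctSharp) (y : OctPair) : OctPair :=
  (s.1 • y.1 + s.2.2 * cayley y.2, s.2.1 • y.2 + cayley y.1 * s.2.2)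

/-- The bilinear version of the quadratic operator. -/
def quad (x y : OctPair) : OctPair := form x y • x - act (sharp x) y

/-- The trilinear version of the triple product. -/
def trip (x y z : OctPair) : OctPair := form x y • z + form z y • x - act (cross x z) y

theorem form_comm (x y : OctPair) : form x y = form y x := by
  simp [form, bil_comm]

theorem form_add_left (x y z : OctPair) : form (x + y) z = form x z + form y z := by
  simp [form, bil_add_left]; ring

theorem form_smul_left (c : ℂ) (x y : OctPair) : form (c • x) y = c * form x y := by
  simp [form, bil_smul_left]; ring

theorem form_add_right (x y z : OctPair) : form x (y + z) = form x y + form x z := by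
  rw [form_comm, form_add_left, form_comm, form_comm z]

theorem form_smul_right (c : ℂ) (x y : OctPair) : form x (c • y) = c * form x y := by
  rw [form_comm, form_smul_left, form_comm]

theorem sharpForm_comm (s t : OctSharp) : sharpForm s t = sharpForm t s := by
  simp [sharpForm, bil_comm]; ring

theorem sharpForm_smul_left (c : ℂ) (s t : OctSharp) :
    sharpForm (c • s) t = c * sharpForm s t := by
  simp [sharpForm, bil_smul_left]; ring

theorem sharp_add (x y : OctPair) : sharp (x + y) = sharp x + sharp y + cross x y := by
  ext1
  · simp [sharp, cross, n_add]
  · ext1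
    · simp [sharp, cross, n_add]
    · simp [sharp, cross, add_mul, mul_add]; abel

theorem sharp_smul (c : ℂ) (x : OctPair) : sharp (c • x) = c ^ 2 • sharp x := by
  simp [sharp, smul_smul, sq, smul_mul_assoc, mul_smul_comm]

theorem cross_comm (x y : OctPair) : cross x y = cross y x := by
  simp [cross, bil_comm, add_comm]

theorem cross_self (x : OctPair) : cross x x = (2 : ℂ) • sharp x := by
  simp [cross, sharp, bil_self, two_smul, two_mul]

theorem cross_add_left (x y z : OctPair) : cross (x + y) z = cross x z + cross y z := by
  ext1
  · simp [cross, bil_add_left]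
  · ext1
    · simp [cross, bil_add_left]
    · simp [cross, add_mul, mul_add]; abel

theorem cross_smul_left (c : ℂ) (x y : OctPair) : cross (c • x) y = c • cross x y := by
  simp [cross, bil_smul_left, smul_mul_assoc, mul_smul_comm]

theorem act_add_left (s t : OctSharp) (y : OctPair) : act (s + t) y = act s y + act t y := by
  ext1
  · simp [act, add_mul, add_smul]; abel
  · simp [act, mul_add, add_smul]; abel

theorem act_smul_left (c : ℂ) (s : OctSharp) (y : OctPair) : act (c • s) y = c • act s y := by
  ext1 <;> simp [act, smul_smul, smul_mul_assoc, mul_smul_comm]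

theorem act_add_right (s : OctSharp) (x y : OctPair) : act s (x + y) = act s x + act s y := by
  ext1
  · simp [act, mul_add, cayley_add]; abel
  · simp [act, add_mul, cayley_add]; abel

theorem act_smul_right (c : ℂ) (s : OctSharp) (y : OctPair) : act s (c • y) = c • act s y := by
  ext1
  · simp [act, cayley_smul, smul_comm c, smul_mul_assoc, mul_smul_comm]
  · simp [act, cayley_smul, smul_comm c, smul_mul_assoc, mul_smul_comm]

/-- Thus `act` and `cross` are transposes of each other; the self-adjointness properties of `trip`
rest on this. -/
theorem form_act (s : OctSharp) (x y : OctPair) : form (act s x) y = sharpForm s (cross x y) := by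
  simp only [form, act, sharpForm, cross, bil_add_left, bil_smul_left, bil_add_right]
  rw [bil_mul_right, cayley_cayley, bil_mul_left, cayley_cayley]
  ring

/-- The term `(x₂ : y₂) x₁` of the definition is absorbed by the linearised law `(ab)b~ = n(b)a`,
which leaves a single product of three factors. -/
theorem quad_fst (x y : OctPair) : (quad x y).1 =
    bil x.1 y.1 • x.1 - n x.1 • y.1 + (x.1 * y.2) * cayley x.2 := by
  have h := mul_mul_cayley_add x.1 x.2 y.2
  simp only [quad, form, act, sharp, Prod.fst_sub, Prod.smul_fst]
  linear_combination (norm := module) -h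

theorem quad_snd (x y : OctPair) : (quad x y).2 =
    bil x.2 y.2 • x.2 - n x.2 • y.2 + cayley x.1 * (y.1 * x.2) := by
  have h := cayley_mul_mul_add x.1 x.2 y.1
  simp only [quad, form, act, sharp, Prod.snd_sub, Prod.smul_snd]
  linear_combination (norm := module) -h

theorem trip_fst (x y z : OctPair) : (trip x y z).1 =
    bil x.1 y.1 • z.1 + bil z.1 y.1 • x.1 - bil x.1 z.1 • y.1 + (x.1 * y.2) * cayley z.2
      + (z.1 * y.2) * cayley x.2 := by
  have h := mul_mul_cayley_add x.1 z.2 y.2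
  have h' := mul_mul_cayley_add z.1 x.2 y.2
  simp only [trip, form, act, cross, Prod.fst_sub, Prod.fst_add, Prod.smul_fst, add_mul]
  linear_combination (norm := module) -h - h'

theorem trip_snd (x y z : OctPair) : (trip x y z).2 =
    bil x.2 y.2 • z.2 + bil z.2 y.2 • x.2 - bil x.2 z.2 • y.2 + cayley x.1 * (y.1 * z.2)
      + cayley z.1 * (y.1 * x.2) := by
  have h := cayley_mul_mul_add x.1 z.2 y.1
  have h' := cayley_mul_mul_add z.1 x.2 y.1
  simp only [trip, form, act, cross, Prod.snd_sub, Prod.snd_add, Prod.smul_snd, mul_add]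
  linear_combination (norm := module) -h - h'

theorem quad_add_left (x y z : OctPair) : quad (x + z) y = quad x y + quad z y + trip x y z := by
  simp only [quad, trip, sharp_add, form_add_left, act_add_left]
  module

theorem trip_comm (x y z : OctPair) : trip x y z = trip z y x := by
  simp only [trip, cross_comm x z]
  abel

theorem trip_self (x y : OctPair) : trip x y x = (2 : ℂ) • quad x y := by
  simp only [trip, quad, cross_self, act_smul_left]
  module

theorem form_trip (x y z w : OctPair) : form (trip x y z) w = form z (trip y x w) := by
  simp only [trip, sub_eq_add_neg, ← neg_one_smul ℂ (act _ _), form_add_left, form_smul_left,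
    form_add_right, form_smul_right]
  rw [form_act, form_comm z (act _ _), form_act, sharpForm_comm, cross_comm x z, form_comm y x, form_comm x w]
  ring

/-! ### Automorphisms -/

/-- A pair of linear automorphisms compatible with all operations. -/
structure IsAutomorphism (g g' : OctPair ≃ₗ[ℂ] OctPair) : Prop where
  map_quad : ∀ x y, g (quad x y) = quad (g x) (g' y)
  map_quad' : ∀ x y, g' (quad y x) = quad (g' y) (g x)
  form : ∀ x y, form (g x) (g' y) = form x y
  sharpForm : ∀ x y, sharpForm (sharp (g x)) (sharp (g' y)) = sharpForm (sharp x) (sharp y)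

namespace IsAutomorphism

variable {g g' : OctPair ≃ₗ[ℂ] OctPair}

theorem trans {k k' : OctPair ≃ₗ[ℂ] OctPair} (hg : IsAutomorphism g g')
    (hk : IsAutomorphism k k') : IsAutomorphism (g ≪≫ₗ k) (g' ≪≫ₗ k') where
  map_quad x y := by simp [hg.map_quad, hk.map_quad]
  map_quad' x y := by simp [hg.map_quad', hk.map_quad']
  form x y := by simp [hg.form, hk.form]
  sharpForm x y := by simp [hg.sharpForm, hk.sharpForm]

theorem symm (hg : IsAutomorphism g g') : IsAutomorphism g' g :=
  ⟨fun x y => hg.map_quad' y x, fun x y => hg.map_quad y x,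
    fun x y => by rw [form_comm, hg.form, form_comm],
    fun x y => by rw [sharpForm_comm, hg.sharpForm, sharpForm_comm]⟩

theorem map_trip (hg : IsAutomorphism g g') (x y z : OctPair) :
    g (trip x y z) = trip (g x) (g' y) (g z) := by
  have h : trip x y z = quad (x + z) y - quad x y - quad z y := by
    rw [quad_add_left]; abel
  have h' : trip (g x) (g' y) (g z) = quad (g x + g z) (g' y) - quad (g x) (g' y)
      - quad (g z) (g' y) := by
    rw [quad_add_left]; abel
  rw [h, h', map_sub, map_sub, hg.map_quad, hg.map_quad, hg.map_quad, map_add]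

end IsAutomorphism

/-- The transvection `(a, b) ↦ (a + w b~, b)`. -/
def transvection (w : Octonion ℂ) : OctPair ≃ₗ[ℂ] OctPair where
  toFun x := (x.1 + w * cayley x.2, x.2)
  map_add' x y := by
    ext1
    · simp [cayley_add, mul_add]; abel
    · simp
  map_smul' c x := by ext1 <;> simp [cayley_smul, mul_smul_comm]
  invFun x := (x.1 - w * cayley x.2, x.2)
  left_inv x := by simp
  right_inv x := by simp

/-- The transvection `(c, d) ↦ (c, d - c~ w)`. -/
def transvection' (w : Octonion ℂ) : OctPair ≃ₗ[ℂ] OctPair where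
  toFun x := (x.1, x.2 - cayley x.1 * w)
  map_add' x y := by
    ext1
    · simp
    · simp [cayley_add, add_mul]; abel
  map_smul' c x := by ext1 <;> simp [cayley_smul, smul_mul_assoc, smul_sub]
  invFun x := (x.1, x.2 + cayley x.1 * w)
  left_inv x := by simp
  right_inv x := by simp

@[simp] theorem transvection_apply (w : Octonion ℂ) (x : OctPair) :
    transvection w x = (x.1 + w * cayley x.2, x.2) := rfl

@[simp] theorem transvection'_apply (w : Octonion ℂ) (x : OctPair) :
    transvection' w x = (x.1, x.2 - cayley x.1 * w) := rfl

/-- The adjoints of the transforms under a transvection. -/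
theorem sharp_transvection (w : Octonion ℂ) (x : OctPair) :
    sharp (transvection w x) =
      (n x.1 + bil (x.1 * x.2) w + n w * n x.2, n x.2, x.1 * x.2 + n x.2 • w) := by
  simp only [sharp, transvection_apply, n_add, n_mul, n_cayley, add_mul, mul_cayley_mul]
  rw [bil_mul_right]
  ring_nf

theorem sharp_transvection' (w : Octonion ℂ) (x : OctPair) :
    sharp (transvection' w x) =
      (n x.1, n x.2 - bil (x.1 * x.2) w + n w * n x.1, x.1 * x.2 - n x.1 • w) := by
  have h : n (x.2 - cayley x.1 * w) = n x.2 + n x.1 * n w - bil x.2 (cayley x.1 * w) := by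
    rw [sub_eq_add_neg, ← neg_one_smul ℂ, n_add, n_smul, bil_smul_right, n_mul, n_cayley]
    ring
  simp only [sharp, transvection'_apply, h, mul_sub, mul_cayley_mul_self]
  rw [bil_mul_left]
  ring_nf

theorem isAutomorphism_transvection (w : Octonion ℂ) :
    IsAutomorphism (transvection w) (transvection' w) := by
  have hform (x y : OctPair) : form (transvection w x) (transvection' w y) = form x y := by
    have h : bil (w * cayley x.2) y.1 = bil x.2 (cayley y.1 * w) := by
      rw [bil_mul_left, bil_cayley, cayley_mul, cayley_cayley]
    simp only [form, transvection_apply, transvection'_apply, bil_add_left, h, sub_eq_add_neg,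
      ← neg_one_smul ℂ (_ * w), bil_add_right, bil_smul_right]
    ring
  refine ⟨fun x y => ?_, fun x y => ?_, hform, fun x y => ?_⟩
  · rw [quad, quad, hform, map_sub, map_smul, sharp_transvection]
    -- The part with `form` is invariant; what remains is the equivariance of `act (sharp x) y`.
    congr 1
    have h := mul_cayley_mul_add (x.1 * x.2) y.1 w
    have h' := mul_cayley_mul_self w y.1
    ext1
    · simp only [act, sharp, transvection_apply, transvection'_apply, cayley_add, cayley_sub,
        cayley_mul, cayley_smul, cayley_cayley, mul_add, add_mul, mul_sub, smul_mul_assoc,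
        mul_smul_comm] at h ⊢
      linear_combination (norm := module) h + n x.2 • h'
    · simp only [act, sharp, transvection_apply, transvection'_apply, mul_add, mul_smul_comm]
      module
  · rw [quad, quad, form_comm (transvection' w y), hform, form_comm y, map_sub, map_smul,
      sharp_transvection']
    congr 1
    have h := mul_mul_cayley_add' x.2 (y.1 * y.2) w
    have h' := mul_cayley_mul x.2 w
    ext1
    · simp only [act, sharp, transvection_apply, transvection'_apply, sub_mul, smul_mul_assoc]
      module
    · simp only [act, sharp, transvection_apply, transvection'_apply, cayley_add,
        cayley_mul, cayley_smul, cayley_cayley, add_mul, mul_sub, smul_mul_assoc,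
        mul_smul_comm] at h ⊢
      linear_combination (norm := module) -h + n y.1 • h'
  · rw [sharp_transvection, sharp_transvection']
    have h (u v r s : Octonion ℂ) (c d : ℂ) : bil (u + c • v) (r - d • s) =
        bil u r - d * bil u s + c * bil v r - c * d * bil v s := by
      rw [sub_eq_add_neg, ← neg_smul, bil_add_left, bil_add_right, bil_add_right, bil_smul_left,
        bil_smul_left, bil_smul_right, bil_smul_right]
      ring
    simp only [sharpForm, h, sharp, bil_self]
    rw [bil_comm w]
    ring

/-- The exchange of the components. -/
def swap : OctPair ≃ₗ[ℂ] OctPair where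
  toFun x := (cayley x.2, cayley x.1)
  map_add' x y := by ext1 <;> simp [cayley_add]
  map_smul' c x := by ext1 <;> simp [cayley_smul]
  invFun x := (cayley x.2, cayley x.1)
  left_inv x := by simp
  right_inv x := by simp

@[simp] theorem swap_apply (x : OctPair) : swap x = (cayley x.2, cayley x.1) := rfl

theorem isAutomorphism_swap : IsAutomorphism swap swap := by
  have hquad (x y : OctPair) : swap (quad x y) = quad (swap x) (swap y) := by
    ext1
    · rw [quad_fst]
      simp [quad_snd, cayley_add, cayley_sub, cayley_smul, cayley_mul, bil_cayley]
    · rw [quad_snd]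
      simp [quad_fst, cayley_add, cayley_sub, cayley_smul, cayley_mul, bil_cayley]
  refine ⟨hquad, fun x y => hquad y x, fun x y => ?_, fun x y => ?_⟩
  · simp [form, bil_cayley, add_comm]
  · simp [sharpForm, sharp, ← cayley_mul, bil_cayley, add_comm]

theorem exists_bil_eq_one {b : Octonion ℂ} (hb : b ≠ 0) : ∃ f, bil b f = 1 := by
  by_contra! h
  refine hb (eq_of_bil_eq fun z => ?_)
  by_contra h'
  rw [bil_zero_left] at h'
  exact h ((bil b z)⁻¹ • z) (by rw [bil_smul_right, inv_mul_cancel₀ h'])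

theorem exists_isAutomorphism_of_n_snd {x : OctPair} (hx : n x.2 ≠ 0) :
    ∃ g g', IsAutomorphism g g' ∧ (g x).1 = 0 := by
  refine ⟨_, _, isAutomorphism_transvection (-(n x.2)⁻¹ • (x.1 * x.2)), ?_⟩
  simp only [transvection_apply, smul_mul_assoc, mul_mul_cayley_self, smul_smul]
  rw [neg_mul, inv_mul_cancel₀ hx]
  simp

theorem exists_isAutomorphism_of_n_fst {x : OctPair} (hx : n x.1 ≠ 0) :
    ∃ g g', IsAutomorphism g g' ∧ (g x).1 = 0 := by
  obtain ⟨g, g', hg, h⟩ := exists_isAutomorphism_of_n_snd (x := swap x) (by simpa)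
  exact ⟨_, _, isAutomorphism_swap.trans hg, by simpa using h⟩

/-- Each element is carried to the second component by an automorphism. -/
theorem exists_isAutomorphism (x : OctPair) :
    ∃ g g', IsAutomorphism g g' ∧ (g x).1 = 0 := by
  by_cases h₂ : n x.2 ≠ 0
  · exact exists_isAutomorphism_of_n_snd h₂
  by_cases h₁ : n x.1 ≠ 0
  · exact exists_isAutomorphism_of_n_fst h₁
  push Not at h₁ h₂
  by_cases h : x.1 * x.2 = 0
  -- With `(x₂ : f) = 1` and `x₁ x₂ = 0`, the linearised law gives `x₁ = (x₁ f) x₂~`, which a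
  -- transvection removes.
  · by_cases hb : x.2 = 0
    · exact ⟨_, _, isAutomorphism_swap, by simp [hb]⟩
    · obtain ⟨f, hf⟩ := exists_bil_eq_one hb
      refine ⟨_, _, isAutomorphism_transvection (-(x.1 * f)), ?_⟩
      have h' := mul_mul_cayley_add x.1 x.2 f
      rw [h, hf, zero_mul, zero_add, one_smul] at h'
      simp [h']
  -- Both components are null here; this transvection gives the first one the norm `(x₁ x₂ : w) =
  -- 1`, which is an earlier case.
  · obtain ⟨w, hw⟩ := exists_bil_eq_one h
    have hs := congrArg Prod.fst (sharp_transvection w x)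
    simp only [sharp, h₁, h₂, hw] at hs
    obtain ⟨g, g', hg, h'⟩ := exists_isAutomorphism_of_n_fst (x := transvection w x) (by
      rw [hs]; simp)
    exact ⟨_, _, (isAutomorphism_transvection w).trans hg, by simpa using h'⟩

/-! ### The Jordan identities -/

theorem quad_of_fst {x : OctPair} (hx : x.1 = 0) (y : OctPair) :
    quad x y = (0, bil x.2 y.2 • x.2 - n x.2 • y.2) := by
  ext1
  · simp [quad_fst, hx, n]
  · simp [quad_snd, hx]

/-- Both sides are equivariant, so `x.1 = 0` may be assumed. Then the first components vanish and
the second ones give the identity in a spin factor. -/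
theorem trip_quad (x y u : OctPair) : trip x y (quad x u) = quad x (trip y x u) := by
  obtain ⟨g, g', hg, h⟩ := exists_isAutomorphism x
  apply g.injective
  rw [hg.map_trip, hg.map_quad, hg.map_quad, hg.symm.map_trip]
  generalize g x = x at *
  generalize g' y = y at *
  generalize g' u = u at *
  rw [quad_of_fst h, quad_of_fst h]
  ext1
  · simp [trip_fst, h]
  · simp only [trip_snd, h, bil_add_left, bil_smul_left, bil_smul_right, bil_add_right,
      sub_eq_add_neg, ← neg_smul, smul_add, smul_smul, cayley_zero, zero_mul, mul_zero, add_zero,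
      bil_self]
    rw [bil_comm u.2 x.2, bil_comm y.2 x.2, bil_comm u.2 y.2]
    module

theorem trip_quad_self (x y z : OctPair) : trip (quad x y) y z = trip x (quad y x) z := by
  obtain ⟨g, g', hg, h⟩ := exists_isAutomorphism x
  apply g.injective
  rw [hg.map_trip, hg.map_trip, hg.map_quad, hg.map_quad']
  generalize g x = x at *
  generalize g' y = y at *
  generalize g z = z at *
  rw [quad_of_fst h]
  have h₁ := mul_mul_cayley_add' (y.1 * x.2) y.2 x.2
  ext1
  · simp only [trip_fst, h, quad_snd]
    simp only [sub_eq_add_neg, ← neg_smul, cayley_add, cayley_smul, mul_add, add_mul,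
      mul_smul_comm, smul_mul_assoc, mul_mul_cayley_self, bil_zero_left, zero_smul, mul_zero,
      zero_mul, add_zero, smul_zero]
    rw [bil_comm x.2 y.2]
    module
  · rw [trip_snd, trip_snd, quad_fst, quad_snd, h]
    rw [mul_mul_cayley_self] at h₁
    have h₂ : (y.1 * x.2 * cayley y.2) * x.2 =
        bil y.2 x.2 • (y.1 * x.2) - n x.2 • (y.1 * y.2) := by
      rw [← h₁, smul_mul_assoc]; abel
    simp only [sub_eq_add_neg, ← neg_smul, bil_add_left, bil_smul_left, bil_smul_right,
      bil_add_right, mul_add, mul_smul_comm, bil_self, h₂, zero_smul, mul_zero,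
      zero_mul, add_zero, zero_add, cayley_zero, smul_zero, neg_zero, bil_zero_right]
    rw [bil_comm x.2 y.2, bil_comm z.2 y.2, bil_comm z.2 x.2]
    module

/-- The powers of an element satisfy a quadratic equation. -/
theorem trip_quad_left (x y : OctPair) : trip x y (quad x y) =
    (2 : ℂ) • (form x y • quad x y - sharpForm (sharp x) (sharp y) • x) := by
  obtain ⟨g, g', hg, h⟩ := exists_isAutomorphism x
  apply g.injective
  rw [hg.map_trip, map_smul, map_sub, map_smul, map_smul, hg.map_quad, ← hg.form, ← hg.sharpForm]
  generalize g x = x at *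
  generalize g' y = y at *
  rw [quad_of_fst h]
  ext1
  · simp [trip_fst, h]
  · simp only [trip_snd, h, sharpForm, sharp, form, sub_eq_add_neg, ← neg_smul, bil_add_left,
      bil_smul_left, bil_smul_right, bil_add_right, bil_self, bil_zero_left, cayley_zero, zero_mul,
      add_zero, zero_add, Prod.smul_snd, Prod.snd_add, smul_add, smul_smul,
      show n (0 : Octonion ℂ) = 0 by simp [n]]
    module

/-! ### The adjoint space -/

/-- The quadratic form on the space of adjoints. -/
def sharpNorm (s : OctSharp) : ℂ := s.1 * s.2.1 - n s.2.2

theorem sharpNorm_sharp (x : OctPair) : sharpNorm (sharp x) = 0 := by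
  simp [sharpNorm, sharp, n_mul]

/-- Isotropy of `s` replaces `n(s₃)` by `s₁ s₂`; the octonion component is then the middle Moufang
identity. -/
theorem sharp_act {s : OctSharp} (hs : sharpNorm s = 0) (y : OctPair) :
    sharp (act s y) = sharpForm s (sharp y) • s := by
  have h : n s.2.2 = s.1 * s.2.1 := (sub_eq_zero.1 hs).symm
  have h₁ : bil y.1 (s.2.2 * cayley y.2) = bil s.2.2 (y.1 * y.2) := by
    rw [bil_comm, bil_mul_right, cayley_cayley]
  have h₂ : bil y.2 (cayley y.1 * s.2.2) = bil s.2.2 (y.1 * y.2) := by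
    rw [bil_comm, bil_mul_left, cayley_cayley]
  ext1
  · simp only [sharp, act, n_add, n_smul, n_mul, n_cayley, bil_smul_left, h, h₁, sharpForm,
      Prod.smul_fst, smul_eq_mul]
    ring
  · ext1
    · simp only [sharp, act, n_add, n_smul, n_mul, n_cayley, bil_smul_left, h, h₂, sharpForm,
        Prod.smul_fst, Prod.smul_snd, smul_eq_mul]
      ring
    · have h₃ := middle_moufang s.2.2 (cayley y.2) (cayley y.1)
      rw [← cayley_mul, cayley_cayley] at h₃
      simp only [sharp, act, sharpForm, Prod.smul_snd, add_mul, mul_add, smul_mul_assoc,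
        mul_smul_comm, h₃, mul_cayley_mul_self, mul_cayley_mul, h]
      module

/-- The other half-spin action. -/
def act' (s : OctSharp) (y : OctPair) : OctPair :=
  (s.2.1 • y.1 - s.2.2 * cayley y.2, s.1 • y.2 - cayley y.1 * s.2.2)

/-- For arbitrary `s` the composite would be `sharpNorm s` times the identity, the Clifford
relation. -/
theorem act'_act {s : OctSharp} (hs : sharpNorm s = 0) (y : OctPair) : act' s (act s y) = 0 := by
  have h : n s.2.2 = s.1 * s.2.1 := (sub_eq_zero.1 hs).symm
  ext1
  · simp only [act, act', cayley_add, cayley_smul, cayley_mul, cayley_cayley, mul_add,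
      mul_smul_comm, mul_cayley_mul_self, h, Prod.fst_zero]
    module
  · simp only [act, act', cayley_add, cayley_smul, cayley_mul, cayley_cayley, add_mul,
      smul_mul_assoc, mul_cayley_mul, h, Prod.snd_zero]
    module

theorem act_act_act {s : OctSharp} (hs : sharpNorm s = 0) (t : OctSharp) (y : OctPair) :
    act s (act t (act s y)) = sharpForm s t • act s y := by
  -- This is the polarised Clifford relation; its second term vanishes on the range of `act s`.
  have h (z : OctPair) : act s (act t z) + act (t.2.1, t.1, -t.2.2) (act' s z) =
      sharpForm s t • z := by
    have h₁ := mul_cayley_mul_add s.2.2 z.1 t.2.2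
    have h₂ := mul_mul_cayley_add' z.2 t.2.2 s.2.2
    rw [bil_comm] at h₂
    ext1
    · simp only [act, act', sharpForm, cayley_add, cayley_sub, cayley_smul, cayley_mul,
        cayley_cayley, mul_add, mul_sub, mul_smul_comm, neg_mul, Prod.fst_add, Prod.smul_fst]
      linear_combination (norm := module) h₁
    · simp only [act, act', sharpForm, cayley_add, cayley_sub, cayley_smul, cayley_mul,
        cayley_cayley, add_mul, sub_mul, smul_mul_assoc, mul_neg, Prod.snd_add, Prod.smul_snd]
      linear_combination (norm := module) h₂
  rw [← h, act'_act hs]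
  simp [act]

end OctPair

/-! ### Trace of `D(x, y)` and determinant of the Bergman operator on pairs. -/

namespace OctPair

theorem trace_eq_add (f : OctPair →ₗ[ℂ] OctPair) : LinearMap.trace ℂ _ f =
    LinearMap.trace ℂ _ (LinearMap.fst ℂ _ _ ∘ₗ f ∘ₗ LinearMap.inl ℂ _ (Octonion ℂ)) +
      LinearMap.trace ℂ _ (LinearMap.snd ℂ _ _ ∘ₗ f ∘ₗ LinearMap.inr ℂ (Octonion ℂ) _) := by
  rw [LinearMap.trace_comp_comm' (f ∘ₗ LinearMap.inl ℂ _ _),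
    LinearMap.trace_comp_comm' (f ∘ₗ LinearMap.inr ℂ _ _), ← map_add]
  congr 1
  refine LinearMap.ext fun x => ?_
  simp [← map_add]

theorem det_eq_mul (f : OctPair →ₗ[ℂ] OctPair) (hf : ∀ v, (f (0, v)).1 = 0) : LinearMap.det f =
    LinearMap.det (LinearMap.fst ℂ _ _ ∘ₗ f ∘ₗ LinearMap.inl ℂ _ (Octonion ℂ)) *
      LinearMap.det (LinearMap.snd ℂ _ _ ∘ₗ f ∘ₗ LinearMap.inr ℂ (Octonion ℂ) _) := by
  let b := Octonion.basis ℂ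
  have h : LinearMap.toMatrix (b.prod b) (b.prod b) f = Matrix.fromBlocks
      (LinearMap.toMatrix b b (LinearMap.fst ℂ _ _ ∘ₗ f ∘ₗ LinearMap.inl ℂ _ (Octonion ℂ))) 0
      (LinearMap.toMatrix b b (LinearMap.snd ℂ _ _ ∘ₗ f ∘ₗ LinearMap.inl ℂ _ (Octonion ℂ)))
      (LinearMap.toMatrix b b (LinearMap.snd ℂ _ _ ∘ₗ f ∘ₗ LinearMap.inr ℂ (Octonion ℂ) _)) := by
    ext (i | i) (j | j) <;> simp [LinearMap.toMatrix_apply, hf]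
  rw [← LinearMap.det_toMatrix (b.prod b), h, Matrix.det_fromBlocks_zero₁₂,
    LinearMap.det_toMatrix, LinearMap.det_toMatrix]

theorem quad_add_right (x y z : OctPair) : quad x (y + z) = quad x y + quad x z := by
  simp only [quad, form_add_right, act_add_right]
  module

theorem quad_smul_right (c : ℂ) (x y : OctPair) : quad x (c • y) = c • quad x y := by
  simp only [quad, form_smul_right, act_smul_right]
  module

theorem trip_add_right (x y z w : OctPair) : trip x y (z + w) = trip x y z + trip x y w := by
  rw [trip_comm, trip_comm x y z, trip_comm x y w]
  simp only [trip, form_add_left, cross_add_left, act_add_left]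
  module

theorem trip_smul_right (c : ℂ) (x y z : OctPair) : trip x y (c • z) = c • trip x y z := by
  rw [trip_comm, trip_comm x y z]
  simp only [trip, form_smul_left, cross_smul_left, act_smul_left]
  module

/-- The operator `D(x, y)`. -/
def tripₗ (x y : OctPair) : OctPair →ₗ[ℂ] OctPair where
  toFun := trip x y
  map_add' := trip_add_right x y
  map_smul' c := trip_smul_right c x y

/-- The Bergman operator. -/
def bergman (x y : OctPair) : OctPair →ₗ[ℂ] OctPair where
  toFun z := z - trip x y z + quad x (quad y z)
  map_add' z w := by
    simp only [trip_add_right, quad_add_right]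
    abel
  map_smul' c z := by
    simp only [trip_smul_right, quad_smul_right, smul_add, smul_sub, RingHom.id_apply]

/-- The product of two operators of the adjoint space. -/
def actAct (s t : OctSharp) : OctPair →ₗ[ℂ] OctPair where
  toFun z := act s (act t z)
  map_add' z w := by simp only [act_add_right]
  map_smul' c z := by simp only [act_smul_right, RingHom.id_apply]

@[simp] theorem tripₗ_apply (x y z : OctPair) : tripₗ x y z = trip x y z := rfl

@[simp] theorem bergman_apply (x y z : OctPair) :
    bergman x y z = z - trip x y z + quad x (quad y z) := rfl

@[simp] theorem actAct_apply (s t : OctSharp) (z : OctPair) :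
    actAct s t z = act s (act t z) := rfl

/-- The linear form `x ↦ (x : y)` on the octonions. -/
def bilₗ (y : Octonion ℂ) : Octonion ℂ →ₗ[ℂ] ℂ where
  toFun x := bil x y
  map_add' x z := bil_add_left x z y
  map_smul' c x := bil_smul_left c x y

@[simp] theorem bilₗ_apply (x y : Octonion ℂ) : bilₗ y x = bil x y := rfl

theorem trace_tripₗ (x y : OctPair) : LinearMap.trace ℂ _ (tripₗ x y) = 12 * form x y := by
  have h₁ : LinearMap.fst ℂ _ _ ∘ₗ tripₗ x y ∘ₗ LinearMap.inl ℂ _ (Octonion ℂ) =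
      bil x.1 y.1 • LinearMap.id + (bilₗ y.1).smulRight x.1 - (bilₗ x.1).smulRight y.1
        + rightOp y.2 x.2 := by
    ext1 u
    simp [trip_fst, bil_comm u x.1]
  have h₂ : LinearMap.snd ℂ _ _ ∘ₗ tripₗ x y ∘ₗ LinearMap.inr ℂ (Octonion ℂ) _ =
      bil x.2 y.2 • LinearMap.id + (bilₗ y.2).smulRight x.2 - (bilₗ x.2).smulRight y.2
        + leftOp y.1 x.1 := by
    ext1 u
    simp [trip_snd, bil_comm u x.2]
  -- The first block contributes `(8 + 1 - 1)(x₁ : y₁) + 4 (x₂ : y₂)`, the second the same with the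
  -- indices exchanged.
  rw [trace_eq_add, h₁, h₂]
  simp only [map_add, map_sub, map_smul, LinearMap.trace_id, finrank_octonion,
    LinearMap.trace_smulRight, trace_rightOp, trace_leftOp, bilₗ_apply, form, smul_eq_mul]
  rw [bil_comm y.1, bil_comm y.2]
  push_cast
  ring

theorem trace_actAct (s t : OctSharp) :
    LinearMap.trace ℂ _ (actAct s t) = 8 * sharpForm s t := by
  have h₁ : LinearMap.fst ℂ _ _ ∘ₗ actAct s t ∘ₗ LinearMap.inl ℂ _ (Octonion ℂ) =
      (s.1 * t.1) • LinearMap.id + leftOp (cayley t.2.2) (cayley s.2.2) := by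
    ext1 u
    simp [act, cayley_mul, smul_smul]
  have h₂ : LinearMap.snd ℂ _ _ ∘ₗ actAct s t ∘ₗ LinearMap.inr ℂ (Octonion ℂ) _ =
      (s.2.1 * t.2.1) • LinearMap.id + rightOp (cayley t.2.2) (cayley s.2.2) := by
    ext1 u
    simp [act, cayley_mul, smul_smul]
  rw [trace_eq_add, h₁, h₂]
  simp only [map_add, map_smul, LinearMap.trace_id, finrank_octonion, trace_rightOp, trace_leftOp,
    bil_cayley, cayley_cayley, sharpForm, smul_eq_mul]
  rw [bil_comm t.2.2]
  push_cast
  ring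

theorem det_bergman_of_fst {x : OctPair} (hx : x.1 = 0) (y : OctPair) :
    LinearMap.det (bergman x y) =
      (1 - form x y + sharpForm (sharp x) (sharp y)) ^ 12 := by
  -- As `x.1 = 0`, the operator is block triangular; the exponent 12 is the sum of 4 from `rightOp`
  -- and 8 from the spin factor.
  rw [det_eq_mul _ fun v => by simp [trip_fst, quad_fst, hx, n]]
  have h₁ : LinearMap.fst ℂ _ _ ∘ₗ bergman x y ∘ₗ LinearMap.inl ℂ _ (Octonion ℂ) =
      1 - rightOp y.2 x.2 := by
    ext1 u
    simp [trip_fst, quad_fst, hx, n]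
  rw [h₁, det_one_sub_rightOp, det_bergman x.2 y.2]
  · simp only [form, sharpForm, sharp, hx, bil_zero_left, zero_mul, zero_add, add_zero,
      show n (0 : Octonion ℂ) = 0 by simp [n]]
    rw [bil_comm y.2]
    ring
  · intro v
    simp only [LinearMap.comp_apply, LinearMap.snd_apply, LinearMap.inr_apply, bergman_apply,
      Prod.snd_add, Prod.snd_sub, trip_snd, quad_snd, quad_fst, hx]
    simp only [cayley_zero, zero_mul, mul_zero, add_zero, bil_add_right, bil_smul_right,
      sub_eq_add_neg, ← neg_smul, smul_add, smul_zero]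
    rw [bil_comm v y.2]
    module

theorem det_bergman (x y : OctPair) : LinearMap.det (bergman x y) =
    (1 - form x y + sharpForm (sharp x) (sharp y)) ^ 12 := by
  obtain ⟨g, g', hg, h⟩ := exists_isAutomorphism x
  rw [← hg.form, ← hg.sharpForm, ← det_bergman_of_fst h, ← LinearMap.det_conj _ g]
  congr 1
  refine LinearMap.ext fun z => ?_
  simp [hg.map_trip, hg.map_quad, hg.map_quad']

end OctPair

/-! ### Complex conjugation, positivity and norm estimates on pairs. -/

namespace OctPair

/-- Complex conjugation of pairs. -/
def conjPair (x : OctPair) : OctPair := (cconj x.1, cconj x.2)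

/-- Complex conjugation on the space of adjoints. -/
def conjSharp (s : OctSharp) : OctSharp := (conj s.1, conj s.2.1, cconj s.2.2)

theorem conjPair_add (x y : OctPair) : conjPair (x + y) = conjPair x + conjPair y := by
  simp [conjPair, cconj_add]

theorem conjPair_smul (c : ℂ) (x : OctPair) : conjPair (c • x) = conj c • conjPair x := by
  simp [conjPair, cconj_smul]

theorem conjPair_sub (x y : OctPair) : conjPair (x - y) = conjPair x - conjPair y := by
  rw [sub_eq_add_neg, ← neg_one_smul ℂ y, conjPair_add, conjPair_smul]
  simp [sub_eq_add_neg]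

@[simp] theorem conjPair_conjPair (x : OctPair) : conjPair (conjPair x) = x := by
  simp [conjPair]

theorem form_conjPair (x y : OctPair) : form (conjPair x) (conjPair y) = conj (form x y) := by
  simp [form, conjPair, bil_cconj]

theorem sharp_conjPair (x : OctPair) : sharp (conjPair x) = conjSharp (sharp x) := by
  simp [sharp, conjPair, conjSharp, n_cconj, cconj_mul]

theorem conjPair_act (s : OctSharp) (y : OctPair) :
    conjPair (act s y) = act (conjSharp s) (conjPair y) := by
  simp [act, conjPair, conjSharp, cconj_add, cconj_smul, cconj_mul, cconj_cayley]

theorem conjPair_quad (x y : OctPair) :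
    conjPair (quad x y) = quad (conjPair x) (conjPair y) := by
  simp [quad, conjPair_sub, conjPair_smul, conjPair_act, sharp_conjPair, form_conjPair]

theorem conjPair_trip (x y z : OctPair) :
    conjPair (trip x y z) = trip (conjPair x) (conjPair y) (conjPair z) := by
  have h (x y z : OctPair) : trip x y z = quad (x + z) y - quad x y - quad z y := by
    rw [quad_add_left]; abel
  rw [h, h, conjPair_sub, conjPair_sub, conjPair_quad, conjPair_quad, conjPair_quad, conjPair_add]

theorem form_conjPair_self (x : OctPair) : form x (conjPair x) =
    (((bil x.1 (cconj x.1)).re + (bil x.2 (cconj x.2)).re : ℝ) : ℂ) := by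
  simp only [form, conjPair, bil_cconj_self, Complex.ofReal_re, Complex.ofReal_add]

theorem form_conjPair_self_re (x : OctPair) : (form x (conjPair x)).re =
    (bil x.1 (cconj x.1)).re + (bil x.2 (cconj x.2)).re := by
  rw [form_conjPair_self, Complex.ofReal_re]

theorem form_conjPair_self_re_nonneg (x : OctPair) : 0 ≤ (form x (conjPair x)).re := by
  rw [form_conjPair_self_re]
  exact add_nonneg (bil_cconj_self_re_nonneg _) (bil_cconj_self_re_nonneg _)

theorem eq_zero_of_form_conjPair_self {x : OctPair} (h : (form x (conjPair x)).re = 0) :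
    x = 0 := by
  rw [form_conjPair_self_re,
    add_eq_zero_iff_of_nonneg (bil_cconj_self_re_nonneg _) (bil_cconj_self_re_nonneg _)] at h
  exact Prod.ext (eq_zero_of_bil_cconj_self h.1) (eq_zero_of_bil_cconj_self h.2)

theorem sharpForm_conjSharp_self (s : OctSharp) : sharpForm s (conjSharp s) =
    ((Complex.normSq s.1 + Complex.normSq s.2.1 + (bil s.2.2 (cconj s.2.2)).re : ℝ) : ℂ) := by
  simp only [sharpForm, conjSharp, bil_cconj_self, Complex.ofReal_re, Complex.ofReal_add,
    Complex.mul_conj]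

theorem sharpForm_conjSharp_self_re (s : OctSharp) : (sharpForm s (conjSharp s)).re =
    Complex.normSq s.1 + Complex.normSq s.2.1 + (bil s.2.2 (cconj s.2.2)).re := by
  rw [sharpForm_conjSharp_self, Complex.ofReal_re]

theorem eq_zero_of_sharpForm_conjSharp_self {s : OctSharp}
    (h : (sharpForm s (conjSharp s)).re = 0) : s = 0 := by
  rw [sharpForm_conjSharp_self_re] at h
  have h₁ := Complex.normSq_nonneg s.1
  have h₂ := Complex.normSq_nonneg s.2.1
  have h₃ := bil_cconj_self_re_nonneg s.2.2
  refine Prod.ext ?_ (Prod.ext ?_ ?_)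
  · exact Complex.normSq_eq_zero.1 (by linarith)
  · exact Complex.normSq_eq_zero.1 (by linarith)
  · exact eq_zero_of_bil_cconj_self (by linarith)

theorem norm_n_le (a : Octonion ℂ) : 2 * ‖n a‖ ≤ (bil a (cconj a)).re := by
  have h : n a = ∑ i, (Octonion.basis ℂ).repr a i * (Octonion.basis ℂ).repr a i := by
    have h' := bil_eq_sum a a
    rw [bil_self] at h'
    exact mul_left_cancel₀ two_ne_zero h'
  rw [bil_cconj_self, Complex.ofReal_re, h]
  gcongr
  refine (norm_sum_le _ _).trans (Finset.sum_le_sum fun i _ => ?_)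
  rw [norm_mul, Complex.norm_mul_self_eq_normSq]

/-- By `bil_mul_mul_add` applied to `a`, `b` and their conjugates, the defect is the squared length
of `ā b`. -/
theorem bil_mul_cconj_mul_le (a b : Octonion ℂ) : (bil (a * b) (cconj (a * b))).re ≤
    (bil a (cconj a)).re * (bil b (cconj b)).re := by
  have h := bil_mul_mul_add a b (cconj a) (cconj b)
  have h' := bil_cconj_self_re_nonneg (cconj a * b)
  rw [cconj_mul, cconj_cconj] at h'
  rw [← cconj_mul, bil_cconj_self a, bil_cconj_self b, ← Complex.ofReal_mul] at h
  have h'' := congrArg Complex.re h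
  rw [Complex.add_re, Complex.ofReal_re] at h''
  rw [bil_cconj_self a, bil_cconj_self b, Complex.ofReal_re, Complex.ofReal_re]
  linarith

/-- With `A`, `B` the squared lengths of the components, the left side is at most `A²/2 + B²/2 +
2AB`, which falls short of `(A + B)²` by `(A² + B²)/2`. The strict inequality is what makes the
eigenvalue in `isPositive_tripleW` positive. -/
theorem two_mul_sharpForm_lt {x : OctPair} (hx : x ≠ 0) :
    2 * (sharpForm (sharp x) (conjSharp (sharp x))).re < (form x (conjPair x)).re ^ 2 := by
  have h₀ : (form x (conjPair x)).re ≠ 0 := fun h => hx (eq_zero_of_form_conjPair_self h)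
  rw [form_conjPair_self_re] at h₀ ⊢
  rw [sharpForm_conjSharp_self_re]
  have h₁ := norm_n_le x.1
  have h₂ := norm_n_le x.2
  have h₃ := bil_mul_cconj_mul_le x.1 x.2
  simp only [sharp, Complex.normSq_eq_norm_sq]
  generalize (bil x.1 (cconj x.1)).re = A at *
  generalize (bil x.2 (cconj x.2)).re = B at *
  have h₄ : (2 * ‖n x.1‖) ^ 2 ≤ A ^ 2 := by gcongr
  have h₅ : (2 * ‖n x.2‖) ^ 2 ≤ B ^ 2 := by gcongr
  have h₆ : 0 < A ^ 2 + B ^ 2 := by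
    by_contra! h
    have hA : A = 0 := by nlinarith [sq_nonneg A, sq_nonneg B]
    have hB : B = 0 := by nlinarith [sq_nonneg A, sq_nonneg B]
    exact h₀ (by rw [hA, hB, add_zero])
  nlinarith

end OctPair

/-! ### Coordinates on `W` -/

open OctPair

/-- The coordinates of `W`. -/
def coordW : W ≃ₗ[ℂ] OctPair where
  toFun x := (x.1.off 1, x.1.off 2)
  map_add' x y := rfl
  map_smul' c x := rfl
  invFun p := ⟨⟨0, ![0, p.1, p.2]⟩, mem_W.2 ⟨rfl, rfl⟩⟩
  left_inv x := by
    obtain ⟨h₁, h₂⟩ := mem_W.1 x.2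
    ext1
    ext1
    · exact h₁.symm
    · funext i
      fin_cases i
      · exact h₂.symm
      · rfl
      · rfl
  right_inv p := rfl

theorem coordW_apply (x : W) : coordW x = (x.1.off 1, x.1.off 2) := rfl

theorem diag_W (x : W) (i : Fin 3) : x.1.diag i = 0 := congrFun (mem_W.1 x.2).1 i

theorem off_W (x : W) : x.1.off 0 = 0 := (mem_W.1 x.2).2

theorem herm_eq (x y : W) : H3.herm x y = form (coordW x) (conjPair (coordW y)) := by
  simp [H3.herm, H3.bil, Fin.sum_univ_three, diag_W, off_W, form, conjPair, coordW_apply, H3.cconj]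

theorem adj_eq (x : W) : H3.adj x = ⟨![0, -(sharp (coordW x)).1, -(sharp (coordW x)).2.1],
    ![cayley (sharp (coordW x)).2.2, 0, 0]⟩ := by
  ext1 <;> funext i <;> fin_cases i <;>
    simp [H3.adj, diag_W, off_W, sharp, coordW_apply, show n (0 : Octonion ℂ) = 0 by simp [n]]

/-- The signs and the Cayley conjugation by which `adj` differs from `sharp` are invisible to the
form. -/
theorem herm_adj (x y : W) : H3.herm (H3.adj x) (H3.adj y) =
    sharpForm (sharp (coordW x)) (conjSharp (sharp (coordW y))) := by
  simp [adj_eq, H3.herm, H3.bil, Fin.sum_univ_three, H3.cconj, sharpForm, conjSharp, cconj_cayley,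
    bil_cayley]

theorem adj_eq_zero {x : W} : H3.adj x = 0 ↔ sharp (coordW x) = 0 := by
  constructor
  · intro h
    refine eq_zero_of_sharpForm_conjSharp_self ?_
    rw [← herm_adj, h]
    simp [H3.herm, H3.bil]
  · intro h
    rw [adj_eq, h]
    ext1 <;> funext i <;> fin_cases i <;> simp

theorem coordW_triple (x y z : W) : coordW (tripleW x y z) =
    trip (coordW x) (conjPair (coordW y)) (coordW z) := by
  have h : (tripleW x y z : H3) =
      H3.herm x y • (z : H3) + H3.herm z y • (x : H3) - H3.frd (H3.frd x z) (H3.cconj y) := rfl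
  rw [coordW_apply, h, trip, herm_eq, herm_eq]
  ext1
  · simp [H3.off_frd, H3.diag_frd, diag_W, off_W, act, cross, coordW_apply, conjPair, H3.cconj,
      cayley_mul]
    rw [cayley_add, cayley_mul, cayley_mul, cayley_cayley, cayley_cayley, cayley_cayley,
      cayley_cayley, add_comm]
  · simp [H3.off_frd, H3.diag_frd, diag_W, off_W, act, cross, coordW_apply, conjPair, H3.cconj,
      cayley_mul]
    rw [cayley_add, cayley_mul, cayley_mul, cayley_cayley, cayley_cayley, cayley_cayley,
      cayley_cayley, add_comm]

theorem coordW_Q (x y : W) : coordW (tripleW.Q x y) =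
    quad (coordW x) (conjPair (coordW y)) := by
  have h : tripleW.Q x y = (1 / 2 : ℂ) • tripleW x y x := rfl
  rw [h, map_smul, coordW_triple, trip_self, smul_smul]
  norm_num

/-! ### Transfer of the algebraic results to `W`. -/

open OctPair

theorem finrank_W : Module.finrank ℂ W = 16 := by
  rw [coordW.finrank_eq, Module.finrank_prod, finrank_octonion]

theorem finrank_W_cast : (Module.finrank ℂ W : ℂ) = 16 := by
  rw [finrank_W]; norm_num

instance : Module.Finite ℂ W := Module.Finite.equiv coordW.symm

theorem Q_apply (x y : W) : tripleW.Q x y = (1 / 2 : ℂ) • tripleW x y x := rfl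

theorem D_apply (x y z : W) : tripleW.D x y z = tripleW x y z := rfl

theorem triple_self (x y : W) : tripleW x y x = (2 : ℂ) • tripleW.Q x y := by
  rw [Q_apply, smul_smul]; norm_num

theorem isHermitianJTS_tripleW : tripleW.IsHermitianJTS where
  symm x y z := coordW.injective (by rw [coordW_triple, coordW_triple, trip_comm])
  jordan₁ x y u := coordW.injective (by
    simp only [D_apply, coordW_triple, coordW_Q, conjPair_trip, conjPair_conjPair, trip_quad])
  jordan₂ x y := LinearMap.ext fun z => coordW.injective (by
    simp only [D_apply, coordW_triple, coordW_Q, conjPair_quad, conjPair_conjPair, trip_quad_self])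

theorem triple_comm (x y z : W) : tripleW x y z = tripleW z y x :=
  isHermitianJTS_tripleW.symm x y z

theorem trace_D (x y : W) : LinearMap.trace ℂ W (tripleW.D x y) = 12 * H3.herm x y := by
  rw [herm_eq, ← trace_tripₗ, ← LinearMap.trace_conj' _ coordW]
  congr 1
  refine LinearMap.ext fun z => ?_
  simp [LinearEquiv.conj_apply, D_apply, coordW_triple]

theorem det_B (x y : W) : LinearMap.det (tripleW.B x y) =
    (1 - H3.herm x y + H3.herm (H3.adj x) (H3.adj y)) ^ 12 := by
  rw [herm_eq, herm_adj, ← sharp_conjPair, ← OctPair.det_bergman, ← LinearMap.det_conj _ coordW]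
  congr 1
  refine LinearMap.ext fun z => ?_
  simp [TripleProduct.B, D_apply, coordW_triple, coordW_Q, conjPair_quad]

/-! ### The Hermitian form -/

theorem herm_symm (x y : W) : H3.herm y x = conj (H3.herm x y) := by
  rw [herm_eq, herm_eq, ← form_conjPair, conjPair_conjPair, form_comm]

theorem herm_self_re (x : W) : ((H3.herm x x).re : ℂ) = H3.herm x x := by
  rw [← Complex.conj_eq_iff_re, ← herm_symm]

theorem herm_self_re_nonneg (x : W) : 0 ≤ (H3.herm x x).re := by
  rw [herm_eq]; exact form_conjPair_self_re_nonneg _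

theorem eq_zero_of_herm_self {x : W} (h : H3.herm x x = 0) : x = 0 := by
  rw [herm_eq] at h
  exact coordW.injective ((eq_zero_of_form_conjPair_self (by rw [h, Complex.zero_re])).trans
    (map_zero _).symm)

theorem herm_self_re_pos {x : W} (hx : x ≠ 0) : 0 < (H3.herm x x).re := by
  refine (herm_self_re_nonneg x).lt_of_ne fun h => hx (eq_zero_of_herm_self ?_)
  rw [← herm_self_re, ← h, Complex.ofReal_zero]

theorem herm_adj_self_re (x : W) :
    ((H3.herm (H3.adj x) (H3.adj x)).re : ℂ) = H3.herm (H3.adj x) (H3.adj x) := by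
  rw [herm_adj, sharpForm_conjSharp_self, Complex.ofReal_re]

theorem adj_eq_zero_of_herm {x : W} (h : H3.herm (H3.adj x) (H3.adj x) = 0) : H3.adj x = 0 := by
  rw [herm_adj] at h
  exact adj_eq_zero.2 (eq_zero_of_sharpForm_conjSharp_self (by rw [h, Complex.zero_re]))

theorem herm_triple (x y z w : W) :
    H3.herm (tripleW x y z) w = H3.herm z (tripleW y x w) := by
  rw [herm_eq, herm_eq, coordW_triple, coordW_triple, form_trip, conjPair_trip, conjPair_conjPair]

theorem eq_of_herm_eq {x y : W} (h : ∀ z : W, H3.herm x z = H3.herm y z) : x = y := by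
  refine sub_eq_zero.1 (eq_zero_of_herm_self ?_)
  have h' (z : W) : H3.herm (x - y : W) z = 0 := by
    have : ((x - y : W) : H3) = x + (-1 : ℂ) • (y : H3) := by simp [sub_eq_add_neg]
    rw [this, H3.herm_add_left, H3.herm_smul_left, h]
    ring
  exact h' _

theorem herm_zero_left (y : H3) : H3.herm 0 y = 0 := by
  simpa using H3.herm_smul_left 0 0 y

theorem herm_zero_right (y : H3) : H3.herm y 0 = 0 := by
  simpa using H3.herm_smul_right 0 y 0

theorem herm_sub_left (x y z : H3) : H3.herm (x - y) z = H3.herm x z - H3.herm y z := by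
  rw [sub_eq_add_neg, ← neg_one_smul ℂ y, H3.herm_add_left, H3.herm_smul_left]
  ring

theorem herm_sub_right (x y z : H3) : H3.herm x (y - z) = H3.herm x y - H3.herm x z := by
  rw [sub_eq_add_neg, ← neg_one_smul ℂ z, H3.herm_add_right, H3.herm_smul_right]
  simp [sub_eq_add_neg]

/-! ### Powers -/

/-- This quadratic relation keeps all powers of `x` in the span of `x` and `Q(x)y`, and it restricts
the lengths of tripotents. -/
theorem triple_Q (x y : W) : tripleW x y (tripleW.Q x y) = (2 : ℂ) •
    (H3.herm x y • tripleW.Q x y - H3.herm (H3.adj x) (H3.adj y) • x) := by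
  apply coordW.injective
  simp only [coordW_triple, coordW_Q, map_smul, map_sub, trip_quad_left, herm_eq, herm_adj,
    sharp_conjPair]

theorem herm_Q_self (x : W) : H3.herm (tripleW.Q x x) x =
    H3.herm x x ^ 2 - 2 * H3.herm (H3.adj x) (H3.adj x) := by
  rw [herm_eq, coordW_Q, quad, sub_eq_add_neg, ← neg_one_smul ℂ (act _ _), form_add_left,
    form_smul_left, form_smul_left, form_act, cross_self, sharpForm_comm, sharpForm_smul_left,
    sharpForm_comm, sharp_conjPair, herm_eq, herm_adj]
  ring

theorem isPositive_tripleW : tripleW.IsPositive := by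
  intro x c hx h
  have h₁ := two_mul_sharpForm_lt (x := coordW x) (by simpa using hx)
  have h₂ := herm_Q_self x
  rw [← herm_eq, ← herm_adj] at h₁
  rw [h, Submodule.coe_smul, H3.herm_smul_left, ← herm_self_re, ← herm_adj_self_re] at h₂
  have h₃ := herm_self_re_pos hx
  generalize (H3.herm x x).re = r at *
  generalize (H3.herm (H3.adj x) (H3.adj x)).re = m at *
  -- Pairing `Q(x)x = cx` with `x` gives `c r = r² - 2m`.
  have hc : c = (((r ^ 2 - 2 * m) / r : ℝ) : ℂ) := by
    have hr : (r : ℂ) ≠ 0 := by exact_mod_cast h₃.ne'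
    push_cast
    field_simp
    linear_combination h₂
  rw [hc, Complex.ofReal_im, Complex.ofReal_re]
  exact ⟨rfl, div_pos (by linarith) h₃⟩

theorem hasRank_tripleW : tripleW.HasRank 2 := by
  have hmem (x y : W) (k : ℕ) : tripleW.pow x y k ∈ Submodule.span ℂ (Set.range ![x, tripleW.Q x y]) := by
    rw [Matrix.range_cons_cons_empty]
    induction k with
    | zero => exact Submodule.subset_span (by simp [TripleProduct.pow])
    | succ k ih =>
      rw [Submodule.mem_span_pair] at ih
      obtain ⟨a, b, h⟩ := ih
      have h' : tripleW.pow x y (k + 1) = (1 / 2 : ℂ) • tripleW x y (tripleW.pow x y k) := rfl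
      rw [h', ← h, map_add, map_smul, map_smul, triple_self, triple_Q, Submodule.mem_span_pair]
      refine ⟨-(b * H3.herm (H3.adj x) (H3.adj y)), a + b * H3.herm x y, ?_⟩
      module
  have hspan (x y : W) : Submodule.span ℂ (Set.range (tripleW.pow x y)) =
      Submodule.span ℂ (Set.range ![x, tripleW.Q x y]) := by
    apply le_antisymm
    · rw [Submodule.span_le]
      rintro _ ⟨k, rfl⟩
      exact hmem x y k
    · refine Submodule.span_mono ?_
      rintro _ ⟨i, rfl⟩
      fin_cases i
      · exact ⟨0, rfl⟩
      · exact ⟨1, rfl⟩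
  constructor
  -- For `x = 1` and a real unit `y` orthogonal to `1` in the second component, `Q(x)y = -y` is
  -- independent of `x`.
  · obtain ⟨q, hq₀, hq₁, hq₂, hq₃⟩ :
        ∃ q : ℍ[ℂ], q.re = 0 ∧ q.imI = 1 ∧ q.imJ = 0 ∧ q.imK = 0 :=
      ⟨⟨0, 1, 0, 0⟩, rfl, rfl, rfl, rfl⟩
    let x : W := coordW.symm (0, ⟨1, 0⟩)
    let y : W := coordW.symm (0, ⟨q, 0⟩)
    refine ⟨x, y, ?_⟩
    have hy : tripleW.Q x y = -y := by
      apply coordW.injective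
      rw [coordW_Q, map_neg, quad_of_fst (by simp [x])]
      ext <;> simp [x, y, conjPair, Octonion.cconj, bil_eq, n, hq₀, hq₁, hq₂, hq₃]
    have h : LinearIndependent ℂ ![x, tripleW.Q x y] := by
      rw [hy, LinearIndependent.pair_iff]
      intro s t h
      have h' := congrArg (fun z => (coordW z).2.fst) h
      simp only [x, y, map_add, map_smul, map_neg, map_zero, LinearEquiv.apply_symm_apply] at h'
      have h₁ := congrArg QuaternionAlgebra.re h'
      have h₂ := congrArg QuaternionAlgebra.imI h'
      simp [hq₀, hq₁] at h₁ h₂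
      exact ⟨h₁, h₂⟩
    rw [hspan, finrank_span_eq_card h, Fintype.card_fin]
  · rintro d ⟨x, y, rfl⟩
    rw [hspan]
    exact (finrank_range_le_card _).trans (by simp)

/-! ### Polarised Jordan identities -/

theorem Q_add_left (x y z : W) :
    tripleW.Q (x + y) z = tripleW.Q x z + tripleW.Q y z + tripleW x z y := by
  simp only [Q_apply, map_add, LinearMap.add_apply, triple_comm y z x]
  module

theorem Q_smul_left (c : ℂ) (x z : W) : tripleW.Q (c • x) z = c ^ 2 • tripleW.Q x z := by
  simp only [Q_apply, map_smul, LinearMap.smul_apply]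
  module

theorem triple_Q_polar (x z y u : W) :
    tripleW x y (tripleW x u z) + tripleW z y (tripleW.Q x u) =
      tripleW.Q x (tripleW y z u) + tripleW x (tripleW y x u) z := by
  have h (v : W) : tripleW v y (tripleW.Q v u) = tripleW.Q v (tripleW y v u) :=
    isHermitianJTS_tripleW.jordan₁ v y u
  -- The Jordan identity is cubic in `v`. Half the difference of its values at `x + z` and `x - z`
  -- is the part odd in `z`; subtracting the value at `z` leaves the linear part.
  have h₁ := h (x + z)
  have h₂ := h (x + (-1 : ℂ) • z)
  have h₃ := h z
  simp only [Q_add_left, Q_smul_left, map_add, map_smul, map_smulₛₗ, LinearMap.add_apply,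
    LinearMap.smul_apply, smul_add, smul_smul] at h₁ h₂
  simp only [map_neg, map_one] at h₂
  linear_combination (norm := module) (1 / 2 : ℂ) • h₁ - (1 / 2 : ℂ) • h₂ - h₃

theorem triple_Q_left_polar (x y z w : W) :
    tripleW (tripleW.Q x y) z w + tripleW (tripleW.Q x z) y w = tripleW x (tripleW y x z) w := by
  have h (y : W) : tripleW (tripleW.Q x y) y w = tripleW x (tripleW.Q y x) w :=
    LinearMap.congr_fun (isHermitianJTS_tripleW.jordan₂ x y) w
  have h₁ := h (y + z)
  have h₂ := h y
  have h₃ := h z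
  simp only [Q_add_left, map_add, LinearMap.add_apply] at h₁
  linear_combination (norm := module) h₁ - h₂ - h₃

/-! ### Tripotents -/

theorem triple_self_of_isTripotent {x : W} (hx : tripleW.IsTripotent x) :
    tripleW x x x = (2 : ℂ) • x := by
  rw [triple_self, show tripleW.Q x x = x from hx]

theorem D_D_of_isTripotent {x : W} (hx : tripleW.IsTripotent x) (z : W) :
    tripleW x x (tripleW x x z) = tripleW x x z + (2 : ℂ) • tripleW.Q x (tripleW.Q x z) := by
  have h := triple_Q_polar x z x x
  rw [show tripleW.Q x x = x from hx, triple_self_of_isTripotent hx, triple_self,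
    map_smulₛₗ, map_smulₛₗ, LinearMap.smul_apply, triple_comm z x x] at h
  simp only [map_ofNat] at h
  linear_combination (norm := module) h

theorem Q_of_adj_eq_zero {c : W} (hc : H3.adj c = 0) (z : W) :
    tripleW.Q c z = H3.herm c z • c := by
  apply coordW.injective
  rw [coordW_Q, quad, adj_eq_zero.1 hc, map_smul, herm_eq]
  simp [act]

theorem isTripotent_of_herm_eq_one {c : W} (h₁ : H3.herm c c = 1) (h₂ : H3.adj c = 0) :
    tripleW.IsTripotent c := by
  rw [TripleProduct.IsTripotent, Q_of_adj_eq_zero h₂, h₁, one_smul]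

/-- The squared length of `Q(x)x - x` is `2 - 2 - 2 + 2 = 0`. -/
theorem isTripotent_of_herm_eq_two {x : W} (h₁ : H3.herm x x = 2)
    (h₂ : H3.herm (H3.adj x) (H3.adj x) = 1) : tripleW.IsTripotent x := by
  have h₃ := herm_Q_self x
  have h₄ : H3.herm x (tripleW.Q x x) = 2 := by
    rw [herm_symm (tripleW.Q x x), h₃, h₁, h₂]
    simp only [map_sub, map_mul, map_pow, map_one, map_ofNat]
    norm_num
  have h₅ : H3.herm (tripleW.Q x x) (tripleW.Q x x) = 2 := by
    have h := herm_triple x x x (tripleW.Q x x)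
    rw [triple_self, triple_Q, h₁, h₂, Submodule.coe_smul, Submodule.coe_smul, H3.herm_smul_left,
      H3.herm_smul_right, Submodule.coe_sub, Submodule.coe_smul, Submodule.coe_smul,
      herm_sub_right, H3.herm_smul_right, H3.herm_smul_right, h₁, h₄] at h
    simp only [map_one, map_ofNat] at h
    linear_combination h / 2
  refine sub_eq_zero.1 (eq_zero_of_herm_self ?_)
  rw [Submodule.coe_sub, herm_sub_left, herm_sub_right, herm_sub_right, h₃, h₄, h₅, h₁, h₂]
  norm_num

theorem isTripotent_iff {x : W} : tripleW.IsTripotent x ↔ x = 0 ∨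
    (H3.herm x x = 1 ∧ H3.adj x = 0) ∨
      (H3.herm x x = 2 ∧ H3.herm (H3.adj x) (H3.adj x) = 1) := by
  constructor
  · intro hx
    refine or_iff_not_imp_left.2 fun h₀ => ?_
    have h₁ := triple_Q x x
    have h₂ := herm_Q_self x
    rw [show tripleW.Q x x = x from hx] at h₁ h₂
    rw [triple_self_of_isTripotent hx, ← sub_smul] at h₁
    have h₃ := smul_left_injective ℂ h₀
      ((smul_right_injective W (two_ne_zero (α := ℂ)) h₁).symm.trans (one_smul ℂ x).symm)
    -- Eliminate `m` from `r - m = 1` and `r = r² - 2m`.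
    have h₄ : (H3.herm x x - 1) * (H3.herm x x - 2) = 0 := by
      linear_combination -h₂ - 2 * h₃
    rcases mul_eq_zero.1 h₄ with h | h
    · refine Or.inl ⟨sub_eq_zero.1 h, adj_eq_zero_of_herm ?_⟩
      linear_combination h - h₃
    · refine Or.inr ⟨sub_eq_zero.1 h, ?_⟩
      linear_combination h - h₃
  · rintro (rfl | ⟨h₁, h₂⟩ | ⟨h₁, h₂⟩)
    · simp [TripleProduct.IsTripotent]
    · exact isTripotent_of_herm_eq_one h₁ h₂
    · exact isTripotent_of_herm_eq_two h₁ h₂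

theorem herm_re_of_isTripotent {x : W} (hx : tripleW.IsTripotent x) (h₀ : x ≠ 0) :
    1 ≤ (H3.herm x x).re := by
  rcases isTripotent_iff.1 hx with h | ⟨h, -⟩ | ⟨h, -⟩
  · exact absurd h h₀
  · simp [h]
  · simp [h]

/-- The trace formula turns `D(x, y) = 0` into a statement about the form. -/
theorem herm_of_orthogonal {x y : W} (h : tripleW.Orthogonal x y) : H3.herm x y = 0 := by
  have h' := trace_D x y
  rw [show tripleW.D x y = 0 from h, map_zero] at h'
  simpa using h'.symm

theorem herm_add_of_orthogonal {x y : W} (h : tripleW.Orthogonal x y) :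
    H3.herm (x + y : W) (x + y : W) = H3.herm x x + H3.herm y y := by
  rw [Submodule.coe_add, H3.herm_add_left, H3.herm_add_right, H3.herm_add_right, herm_symm x y,
    herm_of_orthogonal h]
  simp

theorem ne_zero_of_herm_eq_one {c : W} (h : H3.herm c c = 1) : c ≠ 0 := by
  rintro rfl
  rw [Submodule.coe_zero, herm_zero_left] at h
  exact zero_ne_one h

/-- Squared lengths add over orthogonal tripotents, and each non-zero one contributes at least 1. -/
theorem isMinimalTripotent_of_herm_eq_one {c : W} (h₁ : H3.herm c c = 1) (h₂ : H3.adj c = 0) :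
    tripleW.IsMinimalTripotent c := by
  refine ⟨isTripotent_of_herm_eq_one h₁ h₂, ne_zero_of_herm_eq_one h₁,
    fun y z hy hz hyz h => ?_⟩
  by_contra! h'
  have h₃ := herm_add_of_orthogonal hyz
  rw [← h, h₁] at h₃
  have h₄ := congrArg Complex.re h₃
  rw [Complex.one_re, Complex.add_re] at h₄
  linarith [herm_re_of_isTripotent hy h'.1, herm_re_of_isTripotent hz h'.2]

/-- An element of the Peirce space `V₀` of a rank one element is orthogonal to it. -/
theorem orthogonal_of_triple_eq_zero {c u : W} (h₁ : H3.herm c c = 1) (h₂ : H3.adj c = 0)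
    (hu : tripleW c c u = 0) :
    H3.herm u c = 0 ∧ tripleW.Orthogonal c u ∧ tripleW.Orthogonal u c := by
  have hc := isTripotent_of_herm_eq_one h₁ h₂
  have h₃ : H3.herm u c = 0 := by
    have h := herm_triple c c u c
    rw [hu, triple_self_of_isTripotent hc, Submodule.coe_smul, H3.herm_smul_right,
      Submodule.coe_zero, herm_zero_left] at h
    simpa using h.symm
  have h₄ (w : W) : tripleW c u w = 0 := by
    -- Here `Q(c)u = (c | u)c = 0` and `{c c u} = 0`, so only `D(c, u)` survives; `D(u, c)` is its
    -- adjoint.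
    have h := triple_Q_left_polar c c u w
    rw [show tripleW.Q c c = c from hc, Q_of_adj_eq_zero h₂ u, herm_symm u c, h₃, hu] at h
    simpa using h
  refine ⟨h₃, LinearMap.ext h₄, LinearMap.ext fun z => eq_of_herm_eq fun w => ?_⟩
  rw [D_apply, herm_triple, h₄, Submodule.coe_zero, herm_zero_right]
  simp [herm_zero_left]

/-! ### Rank one elements -/

/-- The linear form `z ↦ (z | c)`. -/
def hermₗ (c : W) : W →ₗ[ℂ] ℂ where
  toFun z := H3.herm z c
  map_add' x y := H3.herm_add_left x y c
  map_smul' a x := H3.herm_smul_left a x c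

@[simp] theorem hermₗ_apply (c z : W) : hermₗ c z = H3.herm z c := rfl

theorem D_D_of_herm_eq_one {c : W} (h₁ : H3.herm c c = 1) (h₂ : H3.adj c = 0) (z : W) :
    tripleW c c (tripleW c c z) = tripleW c c z + (2 * H3.herm z c) • c := by
  rw [D_D_of_isTripotent (isTripotent_of_herm_eq_one h₁ h₂), Q_of_adj_eq_zero h₂,
    Q_of_adj_eq_zero h₂, Submodule.coe_smul, H3.herm_smul_right, h₁, ← herm_symm, mul_one, smul_smul]

/-- `D(c, c)` is 2 on `c` and has only the eigenvalues 1 and 0 on its orthogonal complement, so `I +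
(· | c)c - D(c, c)` projects onto the kernel; its trace is `16 + 1 - 12`. -/
theorem finrank_ker_D {c : W} (h₁ : H3.herm c c = 1) (h₂ : H3.adj c = 0) :
    Module.finrank ℂ (LinearMap.ker (tripleW.D c c)) = 5 := by
  have hc := triple_self_of_isTripotent (isTripotent_of_herm_eq_one h₁ h₂)
  have h : LinearMap.IsProj (LinearMap.ker (tripleW.D c c))
      (LinearMap.id + (hermₗ c).smulRight c - tripleW.D c c) := by
    constructor
    · intro z
      simp only [LinearMap.mem_ker, LinearMap.sub_apply, LinearMap.add_apply, LinearMap.id_apply,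
        LinearMap.smulRight_apply, hermₗ_apply, map_sub, map_add, map_smul, D_apply,
        D_D_of_herm_eq_one h₁ h₂, hc]
      module
    · intro z hz
      have h₃ := (orthogonal_of_triple_eq_zero h₁ h₂ hz).1
      simp [h₃, show tripleW.D c c z = 0 from hz]
  have ht := h.trace
  rw [map_sub, map_add, LinearMap.trace_id, LinearMap.trace_smulRight, trace_D, hermₗ_apply, h₁,
    finrank_W_cast] at ht
  have : ((Module.finrank ℂ (LinearMap.ker (tripleW.D c c)) : ℕ) : ℂ) = (5 : ℕ) := by
    rw [← ht]; norm_num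
  exact_mod_cast this

/-- Since `(y ± x)^# = y^# ± x × y` are isotropic together with `y^#`, the parallelogram law
applies. -/
theorem sharpNorm_cross {x y : OctPair} (hx : sharp x = 0) : sharpNorm (cross x y) = 0 := by
  have h₁ := sharpNorm_sharp (x + y)
  have h₂ := sharpNorm_sharp (y + (-1 : ℂ) • x)
  have h₃ := sharpNorm_sharp y
  rw [sharp_add, hx, zero_add] at h₁
  rw [sharp_add, sharp_smul, hx, cross_comm, cross_smul_left, smul_zero, add_zero] at h₂
  simp only [sharpNorm, Prod.fst_add, Prod.snd_add, Prod.smul_fst, Prod.smul_snd, n_add, n_smul,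
    bil_smul_right, smul_eq_mul] at *
  linear_combination h₁ / 2 + h₂ / 2 - h₃

theorem adj_smul_eq_zero {c : W} (h : H3.adj c = 0) (a : ℂ) : H3.adj (a • c : W) = 0 := by
  rw [adj_eq_zero] at *
  rw [map_smul, sharp_smul, h, smul_zero]

/-- Each non-zero element has a positive multiple of prescribed positive length. -/
theorem exists_herm_smul_eq {u : W} (hu : u ≠ 0) {s : ℝ} (hs : 0 < s) :
    ∃ a : ℝ, a ≠ 0 ∧ H3.herm ((a : ℂ) • u : W) ((a : ℂ) • u : W) = s := by
  have h := herm_self_re_pos hu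
  refine ⟨√(s / (H3.herm u u).re), by positivity, ?_⟩
  rw [Submodule.coe_smul, H3.herm_smul_left, H3.herm_smul_right, ← herm_self_re,
    Complex.conj_ofReal, ← Complex.ofReal_mul, ← Complex.ofReal_mul, ← mul_assoc,
    Real.mul_self_sqrt (by positivity), Complex.ofReal_re, div_mul_cancel₀ _ h.ne']

/-- The hypothesis amounts to `u = (c × u) × c̄` with `c × u` isotropic, so by `sharp_act` the
adjoint of `u` has the factor `(c × u : c̄^#) = 0`. -/
theorem adj_of_triple_eq_zero {c u : W} (h₁ : H3.herm c c = 1) (h₂ : H3.adj c = 0)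
    (hu : tripleW c c u = 0) : H3.adj u = 0 := by
  have h₃ := (orthogonal_of_triple_eq_zero h₁ h₂ hu).1
  have h₄ := congrArg coordW hu
  rw [herm_eq] at h₁ h₃
  rw [coordW_triple, trip, h₁, h₃, map_zero, one_smul, zero_smul, add_zero, sub_eq_zero] at h₄
  rw [adj_eq_zero] at h₂ ⊢
  rw [h₄, sharp_act (sharpNorm_cross h₂), sharp_conjPair, h₂]
  simp [sharpForm, conjSharp]

theorem exists_orthogonal {c : W} (h₁ : H3.herm c c = 1) (h₂ : H3.adj c = 0) :
    ∃ d : W, H3.herm d d = 1 ∧ H3.adj d = 0 ∧ tripleW c c d = 0 := by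
  have h : LinearMap.ker (tripleW.D c c) ≠ ⊥ := by
    intro h
    have h' := finrank_ker_D h₁ h₂
    rw [h, finrank_bot] at h'
    norm_num at h'
  obtain ⟨u, hu, hu₀⟩ := Submodule.exists_mem_ne_zero_of_ne_bot h
  obtain ⟨a, -, ha⟩ := exists_herm_smul_eq hu₀ one_pos
  refine ⟨(a : ℂ) • u, by simpa using ha,
    adj_smul_eq_zero (adj_of_triple_eq_zero h₁ h₂ hu) _, ?_⟩
  rw [map_smul, show tripleW c c u = 0 from hu, smul_zero]

/-! ### Rank two elements -/

/-- The antilinear operator `y ↦ x^# × ȳ`. -/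
def sharpOp (x y : W) : W := coordW.symm (act (sharp (coordW x)) (conjPair (coordW y)))

theorem coordW_sharpOp (x y : W) :
    coordW (sharpOp x y) = act (sharp (coordW x)) (conjPair (coordW y)) :=
  coordW.apply_symm_apply _

theorem Q_eq_sub_sharpOp (x y : W) : tripleW.Q x y = H3.herm x y • x - sharpOp x y := by
  apply coordW.injective
  rw [coordW_Q, quad, map_sub, map_smul, coordW_sharpOp, herm_eq]

theorem sharpOp_sub (x y z : W) : sharpOp x (y - z) = sharpOp x y - sharpOp x z := by
  apply coordW.injective
  rw [map_sub, coordW_sharpOp, coordW_sharpOp, coordW_sharpOp, map_sub, conjPair_sub,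
    sub_eq_add_neg, ← neg_one_smul ℂ (conjPair _), act_add_right, act_smul_right]
  module

theorem sharpOp_add (x y z : W) : sharpOp x (y + z) = sharpOp x y + sharpOp x z := by
  apply coordW.injective
  rw [map_add, coordW_sharpOp, coordW_sharpOp, coordW_sharpOp, map_add, conjPair_add,
    act_add_right]

theorem sharpOp_smul (c : ℂ) (x y : W) : sharpOp x (c • y) = conj c • sharpOp x y := by
  apply coordW.injective
  rw [map_smul, coordW_sharpOp, coordW_sharpOp, map_smul, conjPair_smul, act_smul_right]

theorem coordW_sharpOp_sharpOp (x y : W) : coordW (sharpOp x (sharpOp x y)) =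
    actAct (sharp (coordW x)) (conjSharp (sharp (coordW x))) (coordW y) := by
  rw [coordW_sharpOp, coordW_sharpOp, conjPair_act, conjPair_conjPair, actAct_apply]

theorem sharp_of_sharpOp_eq {x e : W} (h : sharpOp x e = e) :
    sharp (coordW e) = (H3.herm e e / 2) • sharp (coordW x) := by
  have h₁ := congrArg coordW h
  rw [coordW_sharpOp] at h₁
  have h₂ : H3.herm e e =
      2 * sharpForm (sharp (coordW x)) (sharp (conjPair (coordW e))) := by
    rw [herm_eq]
    nth_rw 1 [← h₁]
    rw [form_act, cross_self, sharpForm_comm, sharpForm_smul_left, sharpForm_comm]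
  rw [h₂, ← h₁, sharp_act (sharpNorm_sharp _), h₁, mul_div_cancel_left₀ _ two_ne_zero]

theorem herm_Q_of_isTripotent {x : W} (hx : tripleW.IsTripotent x) (z : W) :
    H3.herm (tripleW.Q x z) x = H3.herm x z := by
  have h₁ := herm_triple x z x x
  have h₂ := herm_triple x x x z
  rw [triple_self_of_isTripotent hx, Submodule.coe_smul, H3.herm_smul_left] at h₂
  rw [Q_apply, Submodule.coe_smul, H3.herm_smul_left, h₁, triple_comm, ← h₂]
  ring

theorem sharpOp_self {x : W} (h₁ : H3.herm x x = 2)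
    (h₂ : H3.herm (H3.adj x) (H3.adj x) = 1) :
    sharpOp x x = x := by
  have h := Q_eq_sub_sharpOp x x
  rw [show tripleW.Q x x = x from isTripotent_of_herm_eq_two h₁ h₂, h₁] at h
  linear_combination (norm := module) h

/-- `Q(x)` and `-sharpOp x` differ by `(x | ·)x`; these contributions cancel in the square because
`sharpOp x` fixes `x`. -/
theorem Q_Q_eq {x : W} (h₁ : H3.herm x x = 2)
    (h₂ : H3.herm (H3.adj x) (H3.adj x) = 1) (z : W) :
    tripleW.Q x (tripleW.Q x z) = sharpOp x (sharpOp x z) := by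
  have h := herm_Q_of_isTripotent (isTripotent_of_herm_eq_two h₁ h₂) z
  rw [Q_eq_sub_sharpOp x (tripleW.Q x z), herm_symm (tripleW.Q x z), h, Q_eq_sub_sharpOp,
    sharpOp_sub, sharpOp_smul, sharpOp_self h₁ h₂]
  module

theorem Q_Q_Q_Q {x : W} (h₁ : H3.herm x x = 2)
    (h₂ : H3.herm (H3.adj x) (H3.adj x) = 1) (z : W) :
    tripleW.Q x (tripleW.Q x (tripleW.Q x (tripleW.Q x z))) =
    tripleW.Q x (tripleW.Q x z) := by
  rw [Q_Q_eq h₁ h₂, Q_Q_eq h₁ h₂]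
  apply coordW.injective
  rw [coordW_sharpOp_sharpOp, coordW_sharpOp_sharpOp]
  simp only [actAct_apply]
  rw [act_act_act (sharpNorm_sharp _), ← herm_adj, h₂, one_smul]

theorem trace_Q_Q {x : W} (h₁ : H3.herm x x = 2)
    (h₂ : H3.herm (H3.adj x) (H3.adj x) = 1) :
    LinearMap.trace ℂ W ((tripleW.Q x).comp (tripleW.Q x)) = 8 := by
  rw [← LinearMap.trace_conj' _ coordW]
  have h : coordW.conj ((tripleW.Q x).comp (tripleW.Q x)) =
      actAct (sharp (coordW x)) (conjSharp (sharp (coordW x))) := by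
    refine LinearMap.ext fun z => ?_
    rw [LinearEquiv.conj_apply, LinearMap.comp_apply, LinearMap.comp_apply, LinearMap.comp_apply]
    simp only [LinearEquiv.coe_coe]
    rw [Q_Q_eq h₁ h₂, coordW_sharpOp_sharpOp, LinearEquiv.apply_symm_apply]
  rw [h, trace_actAct, ← herm_adj, h₂, mul_one]

theorem exists_Q_eq_neg {x : W} (h₁ : H3.herm x x = 2)
    (h₂ : H3.herm (H3.adj x) (H3.adj x) = 1) :
    ∃ e : W, H3.herm e e = 2 ∧ H3.herm e x = 0 ∧ tripleW.Q x e = -e := by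
  have hx := isTripotent_of_herm_eq_two h₁ h₂
  obtain ⟨z, hz₀, hz, hzx⟩ : ∃ z : W, z ≠ 0 ∧ tripleW.Q x (tripleW.Q x z) = z ∧
      H3.herm z x = 0 := by
    -- Otherwise the idempotent `Q(x)²` would have range spanned by `x` and trace 1, but its trace
    -- is 8.
    by_contra! h
    have hR (w : W) : tripleW.Q x (tripleW.Q x w) =
        (H3.herm (tripleW.Q x (tripleW.Q x w)) x / 2) • x := by
      refine sub_eq_zero.1 ?_
      by_contra h₀
      refine h _ h₀ ?_ ?_
      · rw [map_sub, map_sub, map_smulₛₗ, map_smulₛₗ, Q_Q_Q_Q h₁ h₂]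
        simp only [show tripleW.Q x x = x from hx, Complex.conj_conj]
      · rw [Submodule.coe_sub, herm_sub_left, Submodule.coe_smul, H3.herm_smul_left, h₁]
        ring
    have hR' : (tripleW.Q x).comp (tripleW.Q x) =
        ((1 / 2 : ℂ) • (hermₗ x ∘ₗ (tripleW.Q x).comp (tripleW.Q x))).smulRight x := by
      refine LinearMap.ext fun w => ?_
      rw [LinearMap.comp_apply, hR]
      simp [div_eq_inv_mul]
    have ht := trace_Q_Q h₁ h₂
    rw [hR', LinearMap.trace_smulRight] at ht
    simp [show tripleW.Q x x = x from hx, h₁] at ht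
  have hQ : H3.herm (tripleW.Q x z) x = 0 := by
    rw [herm_Q_of_isTripotent hx, herm_symm z, hzx, map_zero]
  obtain ⟨e, he₀, he, hex⟩ : ∃ e : W, e ≠ 0 ∧ tripleW.Q x e = -e ∧ H3.herm e x = 0 := by
    -- If `Q(x)` fixes `z`, then by antilinearity it negates `iz`.
    by_cases h : z - tripleW.Q x z = 0
    · refine ⟨Complex.I • (z + tripleW.Q x z), ?_, ?_, ?_⟩
      · rw [← sub_eq_zero.1 h]
        simpa [← two_smul ℂ z] using hz₀
      · rw [map_smulₛₗ, map_add, hz, Complex.conj_I]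
        module
      · rw [Submodule.coe_smul, H3.herm_smul_left, Submodule.coe_add, H3.herm_add_left, hzx, hQ]
        simp
    · refine ⟨_, h, ?_, ?_⟩
      · rw [map_sub, hz]
        abel
      · rw [Submodule.coe_sub, herm_sub_left, hzx, hQ, sub_zero]
  obtain ⟨a, -, ha⟩ := exists_herm_smul_eq he₀ two_pos
  refine ⟨(a : ℂ) • e, by simpa using ha, ?_, ?_⟩
  · rw [Submodule.coe_smul, H3.herm_smul_left, hex, mul_zero]
  · rw [map_smulₛₗ, he, Complex.conj_ofReal, smul_neg]

/-- A rank two element is the sum of two orthogonal rank one elements. -/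
theorem exists_eq_add {x : W} (h₁ : H3.herm x x = 2)
    (h₂ : H3.herm (H3.adj x) (H3.adj x) = 1) :
    ∃ c d : W, x = c + d ∧ (H3.herm c c = 1 ∧ H3.adj c = 0) ∧
    (H3.herm d d = 1 ∧ H3.adj d = 0) ∧ tripleW c c d = 0 := by
  obtain ⟨e, he, hex, hQ⟩ := exists_Q_eq_neg h₁ h₂
  have hxe : H3.herm x e = 0 := by rw [herm_symm e, hex, map_zero]
  have hTx := sharpOp_self h₁ h₂
  have hTe : sharpOp x e = e := by
    have h := Q_eq_sub_sharpOp x e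
    rw [hQ, hxe, zero_smul] at h
    linear_combination (norm := module) h
  have hse : sharp (coordW e) = sharp (coordW x) := by
    rw [sharp_of_sharpOp_eq hTe, he, div_self two_ne_zero, one_smul]
  -- `x + e` is also fixed by `sharpOp x` and has squared length 4, so `(x + e)^# = 2 x^# = x^# +
  -- e^#`.
  have hcr : cross (coordW x) (coordW e) = 0 := by
    have h := sharp_of_sharpOp_eq (x := x) (e := x + e) (by rw [sharpOp_add, hTx, hTe])
    rw [map_add, sharp_add, hse, Submodule.coe_add, H3.herm_add_left, H3.herm_add_right,
      H3.herm_add_right, h₁, he, hex, hxe] at h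
    linear_combination (norm := module) h
  have hadj (t : ℂ) (ht : t ^ 2 = -1) : H3.adj ((1 / 2 : ℂ) • (x + t • e) : W) = 0 := by
    rw [adj_eq_zero, map_smul, sharp_smul, map_add, map_smul, sharp_add, sharp_smul, cross_comm,
      cross_smul_left, cross_comm, hcr, hse, ht]
    module
  have hherm (s t : ℂ) : H3.herm ((1 / 2 : ℂ) • (x + s • e) : W) ((1 / 2 : ℂ) • (x + t • e) : W)
      = (1 + s * conj t) / 2 := by
    simp only [Submodule.coe_smul, Submodule.coe_add, H3.herm_smul_left, H3.herm_smul_right,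
      H3.herm_add_left, H3.herm_add_right, h₁, he, hex, hxe, map_div₀, map_one, map_ofNat]
    ring
  have hI : Complex.I ^ 2 = -1 := Complex.I_sq
  have hI' : (-Complex.I) ^ 2 = -1 := by rw [neg_sq, Complex.I_sq]
  -- The adjoints of these summands vanish because `i² e^# = -x^#`. Their product `c × d` is `x^#`,
  -- and the antilinear `sharpOp x` exchanges `c` and `d`, whence `{c c d} = d - d`.
  refine ⟨(1 / 2 : ℂ) • (x + Complex.I • e), (1 / 2 : ℂ) • (x + (-Complex.I) • e), ?_,
    ⟨?_, hadj _ hI⟩, ⟨?_, hadj _ hI'⟩, ?_⟩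
  · module
  · rw [hherm]; simp
  · rw [hherm]; simp
  · apply coordW.injective
    rw [coordW_triple, trip, ← herm_eq, ← herm_eq, hherm, hherm]
    have h : cross (coordW ((1 / 2 : ℂ) • (x + Complex.I • e)))
        (coordW ((1 / 2 : ℂ) • (x + (-Complex.I) • e))) = sharp (coordW x) := by
      have hadd (u v w : OctPair) : cross u (v + w) = cross u v + cross u w := by
        rw [cross_comm, cross_add_left, cross_comm u, cross_comm u]
      have hsmul (a : ℂ) (u v : OctPair) : cross u (a • v) = a • cross u v := by
        rw [cross_comm, cross_smul_left, cross_comm u]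
      simp only [map_smul, map_add, cross_smul_left, cross_add_left, hadd, hsmul, OctPair.cross_self, hse,
        hcr, cross_comm (coordW e) (coordW x)]
      have h := congrArg (· • sharp (coordW x)) hI
      linear_combination (norm := module) (-(1 / 2) : ℂ) • h
    rw [h, ← coordW_sharpOp, sharpOp_smul, sharpOp_add, sharpOp_smul, hTx, hTe]
    simp [Complex.conj_ofNat]

theorem isMinimalTripotent_iff {c : W} :
    tripleW.IsMinimalTripotent c ↔ H3.herm c c = 1 ∧ H3.adj c = 0 := by
  refine ⟨fun h => ?_, fun h => isMinimalTripotent_of_herm_eq_one h.1 h.2⟩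
  rcases isTripotent_iff.1 h.1 with h₀ | h₀ | ⟨h₁, h₂⟩
  · exact absurd h₀ h.2.1
  · exact h₀
  · obtain ⟨y, z, hyz, hy, hz, hort⟩ := exists_eq_add h₁ h₂
    rcases h.2.2 y z (isTripotent_of_herm_eq_one hy.1 hy.2) (isTripotent_of_herm_eq_one hz.1 hz.2)
      (orthogonal_of_triple_eq_zero hy.1 hy.2 hort).2.1 hyz with h' | h'
    · exact absurd h' (ne_zero_of_herm_eq_one hy.1)
    · exact absurd h' (ne_zero_of_herm_eq_one hz.1)

theorem isOrthogonalSystem_pair {c d : W} (hc : H3.herm c c = 1 ∧ H3.adj c = 0)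
    (hd : H3.herm d d = 1 ∧ H3.adj d = 0) (h : tripleW c c d = 0) :
    tripleW.IsOrthogonalSystem ![c, d] := by
  have h' := (orthogonal_of_triple_eq_zero hc.1 hc.2 h).2
  constructor
  · intro i
    fin_cases i
    · exact isMinimalTripotent_iff.2 hc
    · exact isMinimalTripotent_iff.2 hd
  · intro i j hij
    fin_cases i <;> fin_cases j
    · exact absurd rfl hij
    · exact h'.1
    · exact h'.2
    · exact absurd rfl hij

theorem isTripotentOfRank_zero_iff {x : W} : tripleW.IsTripotentOfRank 0 x ↔ x = 0 := by
  constructor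
  · rintro ⟨-, e, -, rfl⟩
    simp
  · rintro rfl
    exact ⟨isTripotent_iff.2 (Or.inl rfl), ![], ⟨fun i => i.elim0, fun i => i.elim0⟩, by simp⟩

theorem isTripotentOfRank_one_iff {x : W} :
    tripleW.IsTripotentOfRank 1 x ↔ H3.herm x x = 1 ∧ H3.adj x = 0 := by
  rw [← isMinimalTripotent_iff]
  constructor
  · rintro ⟨-, e, he, rfl⟩
    simpa using he.1 0
  · intro h
    exact ⟨h.1, ![x], ⟨fun i => by simpa using h,
      fun i j hij => absurd (Subsingleton.elim i j) hij⟩, by simp⟩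

theorem isTripotentOfRank_two_iff {x : W} : tripleW.IsTripotentOfRank 2 x ↔
    H3.herm x x = 2 ∧ H3.herm (H3.adj x) (H3.adj x) = 1 := by
  constructor
  · rintro ⟨hx, e, he, rfl⟩
    rw [Fin.sum_univ_two] at hx ⊢
    have h := herm_add_of_orthogonal (he.2 0 1 (by simp))
    rw [(isMinimalTripotent_iff.1 (he.1 0)).1, (isMinimalTripotent_iff.1 (he.1 1)).1] at h
    rcases isTripotent_iff.1 hx with h' | ⟨h', -⟩ | h'
    · rw [h', Submodule.coe_zero, herm_zero_left] at h
      norm_num at h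
    · rw [h'] at h
      norm_num at h
    · exact h'
  · rintro ⟨h₁, h₂⟩
    obtain ⟨y, z, hyz, hy, hz, hort⟩ := exists_eq_add h₁ h₂
    exact ⟨isTripotent_of_herm_eq_two h₁ h₂, ![y, z], isOrthogonalSystem_pair hy hz hort,
      by simpa [Fin.sum_univ_two] using hyz⟩

/-! ### Peirce spaces of a pair of orthogonal rank one elements -/

/-- The data of two orthogonal rank one elements. -/
structure IsRankOnePair (c d : W) : Prop where
  herm_left : H3.herm c c = 1
  adj_left : H3.adj c = 0
  herm_right : H3.herm d d = 1
  adj_right : H3.adj d = 0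
  left : tripleW.Orthogonal c d
  right : tripleW.Orthogonal d c

namespace IsRankOnePair

variable {c d : W}

theorem symm (h : IsRankOnePair c d) : IsRankOnePair d c :=
  ⟨h.herm_right, h.adj_right, h.herm_left, h.adj_left, h.right, h.left⟩

theorem triple_left (h : IsRankOnePair c d) (z : W) : tripleW c d z = 0 :=
  LinearMap.congr_fun h.left z

theorem triple_right (h : IsRankOnePair c d) (z : W) : tripleW d c z = 0 :=
  LinearMap.congr_fun h.right z

theorem isTripotent_left (h : IsRankOnePair c d) : tripleW.IsTripotent c :=
  isTripotent_of_herm_eq_one h.herm_left h.adj_left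

theorem D_add (h : IsRankOnePair c d) (z : W) :
    tripleW (c + d) (c + d) z = tripleW c c z + tripleW d d z := by
  simp [h.triple_left, h.triple_right]

theorem D_left (h : IsRankOnePair c d) : tripleW c c c = (2 : ℂ) • c :=
  triple_self_of_isTripotent h.isTripotent_left

theorem D_left_right (h : IsRankOnePair c d) : tripleW c c d = 0 := by
  rw [triple_comm, h.triple_right]

theorem herm_eq_zero (h : IsRankOnePair c d) : H3.herm c d = 0 := herm_of_orthogonal h.left

theorem isTripotent_add (h : IsRankOnePair c d) : tripleW.IsTripotent (c + d) := by
  rw [TripleProduct.IsTripotent, Q_apply, h.D_add, map_add, map_add, h.D_left, h.symm.D_left,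
    h.D_left_right, h.symm.D_left_right]
  module

theorem herm_add (h : IsRankOnePair c d) : H3.herm (c + d : W) (c + d : W) = 2 := by
  rw [herm_add_of_orthogonal h.left, h.herm_left, h.herm_right]
  norm_num

theorem herm_adj_add (h : IsRankOnePair c d) :
    H3.herm (H3.adj (c + d : W)) (H3.adj (c + d : W)) = 1 := by
  rcases isTripotent_iff.1 h.isTripotent_add with h' | ⟨h', -⟩ | ⟨-, h'⟩
  · have h₁ := h.herm_add
    rw [h', Submodule.coe_zero, herm_zero_left] at h₁
    norm_num at h₁
  · rw [h.herm_add] at h'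
    norm_num at h'
  · exact h'

end IsRankOnePair

/-- The operator `Q(x)²`. -/
def QQ (x : W) : W →ₗ[ℂ] W := (tripleW.Q x).comp (tripleW.Q x)

theorem QQ_apply (x z : W) : QQ x z = tripleW.Q x (tripleW.Q x z) := rfl

theorem D_D_eq {x : W} (hx : tripleW.IsTripotent x) (z : W) :
    tripleW x x (tripleW x x z) = tripleW x x z + (2 : ℂ) • QQ x z :=
  D_D_of_isTripotent hx z

theorem QQ_eq {x : W} (hx : tripleW.IsTripotent x) (z : W) :
    QQ x z = (1 / 2 : ℂ) • (tripleW x x (tripleW x x z) - tripleW x x z) := by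
  rw [D_D_eq hx]
  module

theorem eq_zero_of_idempotent_of_trace {V : Type*} [AddCommGroup V] [Module ℂ V]
    [FiniteDimensional ℂ V] {e g : V →ₗ[ℂ] V} (he : ∀ z, e (e z) = e z) (hg : ∀ z, g (g z) = g z)
    (h : LinearMap.trace ℂ V e + 3 * LinearMap.trace ℂ V g = 0) : e = 0 ∧ g = 0 := by
  rw [(LinearMap.IsIdempotentElem.isProj_range e (LinearMap.ext he)).trace,
    (LinearMap.IsIdempotentElem.isProj_range g (LinearMap.ext hg)).trace] at h
  have h' : Module.finrank ℂ (LinearMap.range e) + 3 * Module.finrank ℂ (LinearMap.range g) = 0 := by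
    exact_mod_cast h
  exact ⟨LinearMap.range_eq_bot.1 (Submodule.finrank_eq_zero.1 (by lia)),
    LinearMap.range_eq_bot.1 (Submodule.finrank_eq_zero.1 (by lia))⟩

/-- An operator `f` with `f² = f + 2g` for an idempotent `g` commuting with it has eigenvalues `2`
and `-1` on the range of `g`, `1` and `0` on its kernel. The trace condition excludes `-1` and
`0`. -/
theorem eigenspaces_of_trace {V : Type*} [AddCommGroup V] [Module ℂ V]
    [FiniteDimensional ℂ V] {f g : V →ₗ[ℂ] V} (hg : ∀ z, g (g z) = g z)
    (hfg : ∀ z, g (f z) = f (g z)) (hf : ∀ z, f (f z) = f z + (2 : ℂ) • g z)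
    (h : (Module.finrank ℂ V : ℂ) - LinearMap.trace ℂ V f + LinearMap.trace ℂ V g = 0) (z : V) :
    f (g z) = (2 : ℂ) • g z ∧ f (z - g z) = z - g z := by
  obtain ⟨e, he⟩ : ∃ e : V →ₗ[ℂ] V, ∀ z, e z = z - g z - f (z - g z) :=
    ⟨(LinearMap.id - f) ∘ₗ (LinearMap.id - g), fun z => by simp⟩
  obtain ⟨k, hk⟩ : ∃ k : V →ₗ[ℂ] V, ∀ z, k z = (1 / 3 : ℂ) • ((2 : ℂ) • g z - f (g z)) :=
    ⟨(1 / 3 : ℂ) • ((2 : ℂ) • LinearMap.id - f) ∘ₗ g, fun z => by simp⟩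
  -- `e` and `k` project onto the eigenspaces of `f` for 0 and -1, where `1 - f + g` takes the
  -- values 1 and 3; it vanishes on the others.
  have hsum : e + (3 : ℂ) • k = LinearMap.id - f + g := by
    refine LinearMap.ext fun z => ?_
    simp only [LinearMap.add_apply, LinearMap.smul_apply, LinearMap.sub_apply, LinearMap.id_apply,
      he, hk, map_sub]
    module
  have h₀ := eq_zero_of_idempotent_of_trace (e := e) (g := k)
    (fun z => by
      simp only [he, map_sub, hfg, hg, hf]
      module)
    (fun z => by
      simp only [hk, map_sub, map_smul, hfg, hg, hf]
      module)
    (by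
      have h' := congrArg (LinearMap.trace ℂ V) hsum
      rw [map_add, map_add, map_sub, map_smul, LinearMap.trace_id, h, smul_eq_mul] at h'
      exact h')
  have h₁ := he z
  have h₂ := hk z
  rw [h₀.1, LinearMap.zero_apply] at h₁
  rw [h₀.2, LinearMap.zero_apply] at h₂
  constructor
  · linear_combination (norm := module) (3 : ℂ) • h₂
  · linear_combination (norm := module) h₁

theorem QQ_QQ {x : W} (h₁ : H3.herm x x = 2) (h₂ : H3.herm (H3.adj x) (H3.adj x) = 1) (z : W) :
    QQ x (QQ x z) = QQ x z := by
  rw [QQ_apply, QQ_apply, Q_Q_Q_Q h₁ h₂]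

theorem trace_QQ {x : W} (h₁ : H3.herm x x = 2) (h₂ : H3.herm (H3.adj x) (H3.adj x) = 1) :
    LinearMap.trace ℂ W (QQ x) = 8 := by
  rw [QQ, trace_Q_Q h₁ h₂]

theorem QQ_D {x : W} (hx : tripleW.IsTripotent x) (z : W) :
    QQ x (tripleW.D x x z) = tripleW.D x x (QQ x z) := by
  simp only [D_apply, QQ_eq hx, map_smul, map_sub]

/-- For a rank two element, `D(x, x)` is `2` on the range of `Q(x)²` and `1` on the kernel. -/
theorem D_QQ {x : W} (h₁ : H3.herm x x = 2) (h₂ : H3.herm (H3.adj x) (H3.adj x) = 1) (z : W) :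
    tripleW.D x x (QQ x z) = (2 : ℂ) • QQ x z ∧
      tripleW.D x x (z - QQ x z) = z - QQ x z := by
  have hx := isTripotent_of_herm_eq_two h₁ h₂
  have ht : (Module.finrank ℂ W : ℂ) - LinearMap.trace ℂ W (tripleW.D x x) +
      LinearMap.trace ℂ W (QQ x) = 0 := by
    rw [trace_D, h₁, finrank_W_cast, trace_QQ h₁ h₂]
    norm_num
  have hD (z : W) : tripleW.D x x (tripleW.D x x z) = tripleW.D x x z + (2 : ℂ) • QQ x z :=
    D_D_eq hx z
  have hg := QQ_QQ h₁ h₂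
  have hc := QQ_D hx
  generalize QQ x = g at *
  generalize tripleW.D x x = f at *
  exact eigenspaces_of_trace hg hc hD ht z

namespace IsRankOnePair

variable {c d : W}

theorem herm_QQ (h : IsRankOnePair c d) (z : W) :
    H3.herm (QQ (c + d) z) c = H3.herm z c := by
  have h₁ (z : W) : H3.herm (tripleW (c + d) (c + d) z) c = 2 * H3.herm z c := by
    rw [herm_triple, h.D_add, h.D_left, triple_comm d d c, h.triple_left, add_zero,
      Submodule.coe_smul, H3.herm_smul_right]
    simp [Complex.conj_ofNat]
  rw [QQ_eq h.isTripotent_add, Submodule.coe_smul, H3.herm_smul_left, Submodule.coe_sub,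
    herm_sub_left, h₁, h₁]
  ring

theorem herm_of_D_eq (h : IsRankOnePair c d) {z : W} {a : ℂ} (ha : a ≠ 2)
    (hz : tripleW c c z = a • z) : H3.herm z c = 0 := by
  have h₁ := herm_triple c c z c
  rw [hz, h.D_left, Submodule.coe_smul, Submodule.coe_smul, H3.herm_smul_left,
    H3.herm_smul_right, Complex.conj_ofNat] at h₁
  have h₂ : (a - 2) * H3.herm z c = 0 := by linear_combination h₁
  exact (mul_eq_zero.1 h₂).resolve_left (sub_ne_zero.2 ha)

theorem D_D (h : IsRankOnePair c d) {z : W} (hz : H3.herm z c = 0) :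
    tripleW c c (tripleW c c z) = tripleW c c z := by
  rw [D_D_of_herm_eq_one h.herm_left h.adj_left, hz, mul_zero, zero_smul, add_zero]

theorem herm_sub_D (h : IsRankOnePair c d) {z : W} (hz : H3.herm z c = 0) :
    H3.herm (z - tripleW c c z : W) (z - tripleW c c z : W) =
      H3.herm z z - H3.herm (tripleW c c z) z := by
  have h₁ := herm_triple c c z (tripleW c c z)
  have h₂ := herm_triple c c z z
  rw [h.D_D hz] at h₁
  rw [Submodule.coe_sub, herm_sub_left, herm_sub_right, herm_sub_right, h₁, h₂]
  ring

/-- On elements orthogonal to `c` and `d`, both `D(c, c)` and `D(d, d)` act as self-adjoint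
idempotents. Since they sum to 2 on `z`, the squared lengths of `z - D(c, c)z` and `z - D(d, d)z`
add up to 0. -/
theorem D_eq_self (h : IsRankOnePair c d) {z : W} (hc : H3.herm z c = 0) (hd : H3.herm z d = 0)
    (hz : tripleW (c + d) (c + d) z = (2 : ℂ) • z) : tripleW c c z = z := by
  have h₁ := h.herm_sub_D hc
  have h₂ := h.symm.herm_sub_D hd
  have h₃ : H3.herm (tripleW c c z) z + H3.herm (tripleW d d z) z = 2 * H3.herm z z := by
    rw [← H3.herm_add_left, ← Submodule.coe_add, ← h.D_add, hz, Submodule.coe_smul,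
      H3.herm_smul_left]
  have h₄ : (H3.herm (z - tripleW c c z : W) (z - tripleW c c z : W)).re +
      (H3.herm (z - tripleW d d z : W) (z - tripleW d d z : W)).re = 0 := by
    rw [← Complex.add_re, h₁, h₂, show H3.herm z z - H3.herm (tripleW c c z) z +
      (H3.herm z z - H3.herm (tripleW d d z) z) = 0 by linear_combination -h₃, Complex.zero_re]
  have h₅ := (add_eq_zero_iff_of_nonneg (herm_self_re_nonneg _) (herm_self_re_nonneg _)).1 h₄
  refine (sub_eq_zero.1 (eq_zero_of_herm_self ?_)).symm
  rw [← herm_self_re, h₅.1, Complex.ofReal_zero]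

/-- The component of an element in the Peirce space `V₁₂`. -/
def proj (c d : W) : W →ₗ[ℂ] W :=
  QQ (c + d) - (hermₗ c).smulRight c - (hermₗ d).smulRight d

theorem proj_apply (c d z : W) :
    proj c d z = QQ (c + d) z - H3.herm z c • c - H3.herm z d • d := rfl

theorem herm_proj (h : IsRankOnePair c d) (z : W) : H3.herm (proj c d z) c = 0 := by
  rw [proj_apply, Submodule.coe_sub, Submodule.coe_sub, herm_sub_left, herm_sub_left,
    h.herm_QQ, Submodule.coe_smul, Submodule.coe_smul, H3.herm_smul_left, H3.herm_smul_left,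
    h.herm_left, h.symm.herm_eq_zero]
  ring

theorem proj_comm (c d z : W) : proj c d z = proj d c z := by
  rw [proj_apply, proj_apply, add_comm c d]
  abel

theorem D_proj (h : IsRankOnePair c d) (z : W) : tripleW c c (proj c d z) = proj c d z := by
  refine h.D_eq_self (h.herm_proj z) (by rw [proj_comm]; exact h.symm.herm_proj z) ?_
  rw [proj_apply, map_sub, map_sub, map_smul, map_smul, ← D_apply,
    (D_QQ h.herm_add h.herm_adj_add z).1, h.D_add, h.D_add, h.D_left, h.symm.D_left, h.D_left_right, h.symm.D_left_right]
  module

theorem finrank_peirce_one_one (h : IsRankOnePair c d) (p : Submodule ℂ W)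
    (hp : ∀ z, z ∈ p ↔ tripleW c c z = z ∧ tripleW d d z = z) : Module.finrank ℂ p = 6 := by
  have hproj : LinearMap.IsProj p (proj c d) := by
    constructor
    · intro z
      exact (hp _).2 ⟨h.D_proj z, by rw [proj_comm]; exact h.symm.D_proj z⟩
    · intro z hz
      obtain ⟨h₁, h₂⟩ := (hp z).1 hz
      rw [proj_apply, h.herm_of_D_eq (a := 1) (by norm_num) (by rw [h₁, one_smul]),
        h.symm.herm_of_D_eq (a := 1) (by norm_num) (by rw [h₂, one_smul]),
        QQ_eq h.isTripotent_add]
      have h₃ : tripleW (c + d) (c + d) z = (2 : ℂ) • z := by rw [h.D_add, h₁, h₂, two_smul]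
      rw [h₃, map_smul, h₃]
      module
  -- The trace of the projection is `8 - 1 - 1`.
  have ht := hproj.trace
  rw [proj, map_sub, map_sub, LinearMap.trace_smulRight, LinearMap.trace_smulRight, hermₗ_apply,
    hermₗ_apply, h.herm_left, h.herm_right,
    trace_QQ h.herm_add h.herm_adj_add] at ht
  have : ((Module.finrank ℂ p : ℕ) : ℂ) = (6 : ℕ) := by
    rw [← ht]; norm_num
  exact_mod_cast this

theorem finrank_peirce_one_zero (h : IsRankOnePair c d) (p : Submodule ℂ W)
    (hp : ∀ z, z ∈ p ↔ tripleW c c z = z ∧ tripleW d d z = 0) : Module.finrank ℂ p = 4 := by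
  have hR (z : W) : tripleW c c (QQ (c + d) z) =
      QQ (c + d) z + H3.herm z c • c - H3.herm z d • d := by
    have h₁ : QQ (c + d) z = proj c d z + H3.herm z c • c + H3.herm z d • d := by
      rw [proj_apply]; abel
    rw [h₁, map_add, map_add, map_smul, map_smul, h.D_proj, h.D_left, h.D_left_right]
    module
  have hproj : LinearMap.IsProj p (tripleW.D c c ∘ₗ (LinearMap.id - QQ (c + d))) := by
    constructor
    · intro z
      have h₁ := (D_QQ h.herm_add h.herm_adj_add z).2
      have hc : H3.herm (z - QQ (c + d) z : W) c = 0 := by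
        rw [Submodule.coe_sub, herm_sub_left, h.herm_QQ, sub_self]
      have hd : H3.herm (z - QQ (c + d) z : W) d = 0 := by
        rw [Submodule.coe_sub, herm_sub_left, add_comm c d, h.symm.herm_QQ, sub_self]
      rw [LinearMap.comp_apply, LinearMap.sub_apply, LinearMap.id_apply, D_apply, hp]
      generalize z - QQ (c + d) z = y at *
      refine ⟨h.D_D hc, ?_⟩
      rw [D_apply, h.D_add] at h₁
      rw [show tripleW c c y = y - tripleW d d y from eq_sub_of_add_eq h₁, map_sub,
        h.symm.D_D hd, sub_self]
    · intro z hz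
      obtain ⟨h₁, h₂⟩ := (hp z).1 hz
      have h₃ : QQ (c + d) z = 0 := by
        have h₃ : tripleW (c + d) (c + d) z = z := by rw [h.D_add, h₁, h₂, add_zero]
        rw [QQ_eq h.isTripotent_add, h₃, h₃, sub_self, smul_zero]
      rw [LinearMap.comp_apply, LinearMap.sub_apply, LinearMap.id_apply, D_apply, h₃, sub_zero, h₁]
  -- In this form the trace of the projection is `12 - 8 - 1 + 1`.
  have hsum : tripleW.D c c ∘ₗ (LinearMap.id - QQ (c + d)) =
      tripleW.D c c - QQ (c + d) - (hermₗ c).smulRight c + (hermₗ d).smulRight d := by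
    refine LinearMap.ext fun z => ?_
    simp only [LinearMap.comp_apply, LinearMap.sub_apply, LinearMap.add_apply, LinearMap.id_apply,
      D_apply, map_sub, hR, LinearMap.smulRight_apply, hermₗ_apply]
    module
  have ht := hproj.trace
  rw [hsum, map_add, map_sub, map_sub, LinearMap.trace_smulRight, LinearMap.trace_smulRight,
    hermₗ_apply, hermₗ_apply, h.herm_left, h.herm_right, trace_D, h.herm_left,
    trace_QQ h.herm_add h.herm_adj_add] at ht
  have : ((Module.finrank ℂ p : ℕ) : ℂ) = (4 : ℕ) := by
    rw [← ht]; norm_num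
  exact_mod_cast this

/-- There is no rank one element orthogonal to two orthogonal ones. -/
theorem not_orthogonal (h : IsRankOnePair c d) {f : W} (hc : IsRankOnePair c f)
    (hd : IsRankOnePair d f) : False := by
  have ht : tripleW.IsTripotent (c + d + f) := by
    have h₁ (z : W) : tripleW (c + d + f) (c + d + f) z =
        tripleW c c z + tripleW d d z + tripleW f f z := by
      simp [h.triple_left, h.triple_right, hc.triple_left, hc.triple_right, hd.triple_left,
        hd.triple_right]
    rw [TripleProduct.IsTripotent, Q_apply, h₁]
    simp only [map_add, h.D_left, h.symm.D_left, hc.symm.D_left, h.D_left_right,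
      h.symm.D_left_right, hc.D_left_right, hc.symm.D_left_right, hd.D_left_right,
      hd.symm.D_left_right]
    module
  have hort : tripleW.Orthogonal (c + d) f := LinearMap.ext fun z => by
    simp [D_apply, hc.triple_left, hd.triple_left]
  have hherm := herm_add_of_orthogonal hort
  rw [h.herm_add, hc.herm_right] at hherm
  -- The sum would be a tripotent of squared length 3.
  rcases isTripotent_iff.1 ht with h' | ⟨h', -⟩ | ⟨h', -⟩
  · rw [h', Submodule.coe_zero, herm_zero_left] at hherm
    norm_num at hherm
  · rw [h'] at hherm
    norm_num at hherm
  · rw [h'] at hherm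
    norm_num at hherm

end IsRankOnePair

/-! ### Frames -/

theorem isRankOnePair_of_isOrthogonalSystem {m : ℕ} {e : Fin m → W}
    (he : tripleW.IsOrthogonalSystem e) {i j : Fin m} (hij : i ≠ j) :
    IsRankOnePair (e i) (e j) :=
  have hi := isMinimalTripotent_iff.1 (he.1 i)
  have hj := isMinimalTripotent_iff.1 (he.1 j)
  ⟨hi.1, hi.2, hj.1, hj.2, he.2 i j hij, he.2 j i hij.symm⟩

theorem exists_rank_one : ∃ c : W, H3.herm c c = 1 ∧ H3.adj c = 0 := by
  -- `(1 + √-1 i)/2` has norm `1/4 - 1/4` and Hermitian square `2 (1/4 + 1/4)`.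
  obtain ⟨q, hq₀, hq₁, hq₂, hq₃⟩ :
      ∃ q : ℍ[ℂ], q.re = 1 / 2 ∧ q.imI = Complex.I / 2 ∧ q.imJ = 0 ∧ q.imK = 0 :=
    ⟨⟨1 / 2, Complex.I / 2, 0, 0⟩, rfl, rfl, rfl, rfl⟩
  refine ⟨coordW.symm (0, ⟨q, 0⟩), ?_, ?_⟩
  · rw [herm_eq, LinearEquiv.apply_symm_apply]
    simp [form, conjPair, bil_eq, Octonion.cconj, hq₀, hq₁, hq₂, hq₃, Complex.conj_ofNat]
    ring_nf
    simp
    norm_num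
  · rw [adj_eq_zero, LinearEquiv.apply_symm_apply]
    simp [sharp, n, Quaternion.normSq_def', hq₀, hq₁, hq₂, hq₃, div_pow]
    norm_num

theorem isFrame_of_isOrthogonalSystem {e : Fin 2 → W} (he : tripleW.IsOrthogonalSystem e) :
    tripleW.IsFrame e := by
  refine ⟨he, fun f hf h => ?_⟩
  have hf' := isMinimalTripotent_iff.1 hf
  have h₁ (i : Fin 2) : IsRankOnePair (e i) f :=
    have hi := isMinimalTripotent_iff.1 (he.1 i)
    ⟨hi.1, hi.2, hf'.1, hf'.2, (h i).1, (h i).2⟩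
  exact (isRankOnePair_of_isOrthogonalSystem he (i := 0) (j := 1) (by simp)).not_orthogonal
    (h₁ 0) (h₁ 1)

theorem length_of_isFrame {m : ℕ} {e : Fin m → W} (he : tripleW.IsFrame e) : m = 2 := by
  obtain _ | _ | _ | m := m
  · obtain ⟨c, hc⟩ := exists_rank_one
    exact absurd (fun i => i.elim0) (he.2 c (isMinimalTripotent_iff.2 hc))
  · have h₀ := isMinimalTripotent_iff.1 (he.1.1 0)
    obtain ⟨d, hd₁, hd₂, hd⟩ := exists_orthogonal h₀.1 h₀.2
    refine absurd (fun i => ?_) (he.2 d (isMinimalTripotent_iff.2 ⟨hd₁, hd₂⟩))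
    obtain rfl : i = 0 := by lia
    exact (orthogonal_of_triple_eq_zero h₀.1 h₀.2 hd).2
  · rfl
  · have h (i j : Fin (m + 3)) (hij : i ≠ j) :=
      isRankOnePair_of_isOrthogonalSystem he.1 hij
    exact ((h ⟨0, by lia⟩ ⟨1, by lia⟩ (by simp)).not_orthogonal
      (h ⟨0, by lia⟩ ⟨2, by lia⟩ (by simp)) (h ⟨1, by lia⟩ ⟨2, by lia⟩ (by simp))).elim

theorem mem_peirce {e : Fin 2 → W} {i j : Option (Fin 2)} {z : W} :
    z ∈ tripleW.peirce e i j ↔ ∀ k : Fin 2, tripleW (e k) (e k) z =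
      ((if i = some k then 1 else 0) + (if j = some k then 1 else 0) : ℂ) • z := by
  simp only [TripleProduct.peirce, Submodule.mem_iInf, LinearMap.mem_ker, LinearMap.sub_apply,
    sub_eq_zero, D_apply, LinearMap.smul_apply, LinearMap.id_apply]

theorem hasInvariants_tripleW : tripleW.HasInvariants 6 4 2 12 where
  rank := hasRank_tripleW
  exists_frame := by
    obtain ⟨c, hc⟩ := exists_rank_one
    obtain ⟨d, hd₁, hd₂, hd⟩ := exists_orthogonal hc.1 hc.2
    exact ⟨_, isFrame_of_isOrthogonalSystem (isOrthogonalSystem_pair hc ⟨hd₁, hd₂⟩ hd)⟩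
  length_frame m e he := length_of_isFrame he
  dim_a e he i j hij := by
    obtain ⟨rfl, rfl⟩ : i = 0 ∧ j = 1 := by lia
    refine (isRankOnePair_of_isOrthogonalSystem he.1 (i := 0) (j := 1)
      (by simp)).finrank_peirce_one_one _ fun z => ?_
    simp [mem_peirce, Fin.forall_fin_two]
  dim_b e he i := by
    fin_cases i
    · refine (isRankOnePair_of_isOrthogonalSystem he.1 (i := 0) (j := 1)
        (by simp)).finrank_peirce_one_zero _ fun z => ?_
      simp [mem_peirce, Fin.forall_fin_two]
    · refine (isRankOnePair_of_isOrthogonalSystem he.1 (i := 1) (j := 0)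
        (by simp)).finrank_peirce_one_zero _ fun z => ?_
      simp [mem_peirce, Fin.forall_fin_two, and_comm]
  genus := by norm_num

/-! ### The trace form and simplicity -/

theorem traceFormPosDef_tripleW : tripleW.TraceFormPosDef := by
  constructor
  · intro x y
    rw [trace_D, trace_D, map_mul, herm_symm x y, Complex.conj_ofNat]
  · intro x hx
    rw [trace_D, ← herm_self_re]
    have h := herm_self_re_pos hx
    norm_num
    exact h

/-- Each complex octonion is the sum of two null octonions. -/
theorem exists_eq_add_of_n_eq_zero (a : Octonion ℂ) :
    ∃ p q, n p = 0 ∧ n q = 0 ∧ a = p + q := by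
  obtain ⟨r, h₀, h₁, h₂, h₃⟩ :
      ∃ r : ℍ[ℂ], r.re = 1 / 2 ∧ r.imI = Complex.I / 2 ∧ r.imJ = 0 ∧ r.imK = 0 :=
    ⟨⟨1 / 2, Complex.I / 2, 0, 0⟩, rfl, rfl, rfl, rfl⟩
  have hr : n (⟨r, 0⟩ : Octonion ℂ) = 0 := by
    simp [n, Quaternion.normSq_def', h₀, h₁, h₂, h₃, div_pow]
    norm_num
  -- The null element `r` and its conjugate sum to 1, so `a = a r + a r~`.
  have hs : r + star r = 1 := by
    ext <;> simp [h₀, h₁, h₂, h₃]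
    norm_num
  refine ⟨a * ⟨r, 0⟩, a * cayley ⟨r, 0⟩, by rw [n_mul, hr, mul_zero],
    by rw [n_mul, n_cayley, hr, mul_zero], ?_⟩
  have hw : (⟨r, 0⟩ + cayley ⟨r, 0⟩ : Octonion ℂ) = ⟨1, 0⟩ := by
    ext1 <;> simp [cayley, hs]
  rw [← oct_mul_add, hw]
  ext1 <;> simp [mul_def]

theorem span_adj_eq_zero : Submodule.span ℂ {c : W | H3.adj c = 0} = ⊤ := by
  refine Submodule.eq_top_iff'.2 fun x => ?_
  obtain ⟨p, q, hp, hq, h₁⟩ := exists_eq_add_of_n_eq_zero (coordW x).1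
  obtain ⟨r, s, hr, hs, h₂⟩ := exists_eq_add_of_n_eq_zero (coordW x).2
  have hx : x = coordW.symm (p, 0) + coordW.symm (q, 0) +
      (coordW.symm (0, r) + coordW.symm (0, s)) := by
    simp only [← map_add]
    rw [LinearEquiv.eq_symm_apply]
    exact Prod.ext (by simp [h₁]) (by simp [h₂])
  have hl (p : Octonion ℂ) (hp : n p = 0) :
      coordW.symm (p, 0) ∈ Submodule.span ℂ {c : W | H3.adj c = 0} :=
    Submodule.subset_span (adj_eq_zero.2 (by simp [sharp, hp, show n (0 : Octonion ℂ) = 0 by simp [n]]))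
  have hr' (p : Octonion ℂ) (hp : n p = 0) :
      coordW.symm (0, p) ∈ Submodule.span ℂ {c : W | H3.adj c = 0} :=
    Submodule.subset_span (adj_eq_zero.2 (by simp [sharp, hp, show n (0 : Octonion ℂ) = 0 by simp [n]]))
  rw [hx]
  exact add_mem (add_mem (hl p hp) (hl q hq)) (add_mem (hr' r hr) (hr' s hs))

/-- A proper subspace misses a rank one element of length one. -/
theorem exists_rank_one_not_mem {p : Submodule ℂ W} (hp : p ≠ ⊤) :
    ∃ c : W, H3.herm c c = 1 ∧ H3.adj c = 0 ∧ c ∉ p := by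
  obtain ⟨c, hc, hcp⟩ : ∃ c : W, H3.adj c = 0 ∧ c ∉ p := by
    by_contra! h
    exact hp (top_le_iff.1 (span_adj_eq_zero ▸ Submodule.span_le.2 h))
  obtain ⟨a, ha, h₁⟩ := exists_herm_smul_eq (u := c) (by rintro rfl; exact hcp p.zero_mem) one_pos
  refine ⟨(a : ℂ) • c, by simpa using h₁, adj_smul_eq_zero hc _, fun h => hcp ?_⟩
  exact (p.smul_mem_iff (Complex.ofReal_ne_zero.2 ha)).1 h

theorem mem_of_isIdeal {I : Submodule ℂ W} (hI : tripleW.IsIdeal I) {c u : W} (hc : H3.adj c = 0)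
    (hu : u ∈ I) (h : H3.herm c u ≠ 0) : c ∈ I := by
  rw [← I.smul_mem_iff h, ← Q_of_adj_eq_zero hc, Q_apply]
  exact I.smul_mem _ (hI u hu c c).2.1

/-- By `mem_of_isIdeal`, `c` is orthogonal to `I`; hence `({c c u} | w) = (c | {c u w}) = 0` for `u
∈ I`. -/
theorem le_ker_D_of_isIdeal {I : Submodule ℂ W} (hI : tripleW.IsIdeal I) {c : W}
    (h₂ : H3.adj c = 0) (hc : c ∉ I) :
    I ≤ LinearMap.ker (tripleW.D c c) := by
  have h (u : W) (hu : u ∈ I) : H3.herm c u = 0 := by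
    by_contra h
    exact hc (mem_of_isIdeal hI h₂ hu h)
  intro u hu
  rw [LinearMap.mem_ker, D_apply]
  refine eq_of_herm_eq fun w => ?_
  rw [triple_comm, herm_triple, Submodule.coe_zero, herm_zero_left, h _ (hI u hu c w).2.1]

theorem isSimple_tripleW : tripleW.IsSimple := by
  constructor
  · obtain ⟨c, h₁, h₂⟩ := exists_rank_one
    refine ⟨c, c, c, ?_⟩
    rw [triple_self_of_isTripotent (isTripotent_of_herm_eq_one h₁ h₂)]
    exact smul_ne_zero two_ne_zero (ne_zero_of_herm_eq_one h₁)
  · intro I hI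
    by_contra! h
    obtain ⟨c, h₁, h₂, hc⟩ := exists_rank_one_not_mem h.2
    have hle := Submodule.finrank_mono (le_ker_D_of_isIdeal hI h₂ hc)
    rw [finrank_ker_D h₁ h₂] at hle
    obtain ⟨d, h₃, h₄, hd⟩ : ∃ d : W, H3.herm d d = 1 ∧ H3.adj d = 0 ∧ d ∈ I := by
      obtain ⟨u, hu, hu₀⟩ := Submodule.exists_mem_ne_zero_of_ne_bot h.1
      obtain ⟨d, h₃, h₄, hd⟩ := exists_rank_one_not_mem (p := LinearMap.ker (hermₗ u)) (by
        intro h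
        refine hu₀ (eq_zero_of_herm_self ?_)
        have : u ∈ LinearMap.ker (hermₗ u) := h ▸ Submodule.mem_top
        exact this)
      exact ⟨d, h₃, h₄, mem_of_isIdeal hI h₄ hu hd⟩
    -- The range has dimension `16 - 5 = 11`, more than the bound 5 found for `I`.
    have hge : Module.finrank ℂ (LinearMap.range (tripleW.D d d)) ≤ Module.finrank ℂ I := by
      refine Submodule.finrank_mono ?_
      rintro _ ⟨z, rfl⟩
      exact (hI d hd d z).1
    have hrank := LinearMap.finrank_range_add_finrank_ker (tripleW.D d d)
    rw [finrank_ker_D h₃ h₄, finrank_W] at hrank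
    lia

end ExceptionalJTS

end

open ExceptionalJTS in
theorem proposition2p18 :
    Module.finrank ℂ W = 16 ∧
    tripleW.IsHermitianJTS ∧
    tripleW.IsPositive ∧
    tripleW.TraceFormPosDef ∧
    tripleW.IsSimple ∧
    tripleW.HasInvariants 6 4 2 12 ∧
    (∀ x y : W, LinearMap.trace ℂ W (tripleW.D x y) = 12 * H3.herm x y) ∧
    (∀ x y : W, LinearMap.det (tripleW.B x y) =
      (1 - H3.herm x y + H3.herm (H3.adj x) (H3.adj y)) ^ 12) ∧
    {x : W | tripleW.IsTripotent x} =
      {0} ∪ {x : W | H3.herm x x = 1 ∧ H3.adj x = 0} ∪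
        {x : W | H3.herm x x = 2 ∧ H3.herm (H3.adj x) (H3.adj x) = 1} ∧
    {x : W | tripleW.IsTripotentOfRank 0 x} = {0} ∧
    {x : W | tripleW.IsTripotentOfRank 1 x} = {x : W | H3.herm x x = 1 ∧ H3.adj x = 0} ∧
    {x : W | tripleW.IsTripotentOfRank 2 x} =
      {x : W | H3.herm x x = 2 ∧ H3.herm (H3.adj x) (H3.adj x) = 1} :=
  ⟨finrank_W, isHermitianJTS_tripleW, isPositive_tripleW, traceFormPosDef_tripleW,
    isSimple_tripleW, hasInvariants_tripleW, trace_D, det_B,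
    Set.ext fun _ => by simp [isTripotent_iff, or_assoc],
    Set.ext fun _ => isTripotentOfRank_zero_iff, Set.ext fun _ => isTripotentOfRank_one_iff,
    Set.ext fun _ => isTripotentOfRank_two_iff⟩
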